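/- Let $\theta,\sigma>0$, $\mu,x_0\in\mathbb R$. An OU process with parameters $(\theta,\mu,\sigma,x_0)$ driven by a standard Brownian motion $W$ is a process with a.s. continuous paths solving $dX_t=\theta(\mu-X_t)\,dt+\sigma\,dW_t$, $X_0=x_0$. For $T>0$ put $\overline X=T^{-1}\int_0^T X_s\,ds$; this random variable is square integrable. Let $X^1,X^2$ be OU processes with common deterministic $\mu,x_0$ and parameters $(\theta_1,\sigma_1)$, $(\theta_2,\sigma_2)$, and let $V=\operatorname{Var}(\overline{X^1}-\overline{X^2})$. Under *common random paths* $X^1,X^2$ are driven by the same Brownian motion; under *independent sampling* they are driven by two independent ones. First order differences at a parameter $p$ with step $\varepsilon$ use the pairs $(p+\varepsilon,p-\varepsilon)$ (central), $(p+\varepsilon,p)$ (forward), $(p,p-\varepsilon)$ (backward). Below, all $O(\cdot)$ bounds hold for all $T>0$ and all real $\varepsilon$ in the stated range, with constants independent of $T$, $\varepsilon$, $\mu$, $x_0$ and of the probability space; expressions $O(T^{-2})$ inside the factor multiplying $\varepsilon^2$ in (2) and (4) do not depend on $\varepsilon$. (1) Under common random paths, for all $\theta_1,\theta_2,\sigma_1,\sigma_2>0$,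 $$\operatorname{Cov}(\overline{X^1},\overline{X^2})=\sigma_1\sigma_2T^{-2}\int_0^T\!\!\int_0^T e^{-\theta_1 s-\theta_2 t}\int_0^{s\wedge t}e^{(\theta_1+\theta_2)r}\,dr\,ds\,dt=\sigma_1\sigma_2T^{-1}\Big(\frac1{\theta_1\theta_2+\theta_2^2}+\frac1{\theta_1^2+\theta_1\theta_2}\Big)+O(T^{-2}),$$ with a constant depending only on $\theta_1,\theta_2,\sigma_1,\sigma_2$. (2) Perturbation of $\theta$ ($\sigma_1=\sigma_2=\sigma$, $|\varepsilon|\le\theta/2$, constants depending only on $\theta,\sigma$), common random paths: for the central difference $$V=\varepsilon^2\big(4\sigma^2T^{-1}\theta^{-4}+O(T^{-2})\big)+O(\varepsilon^4),$$ and for each of the three differences $V=O(\varepsilon^2)$. (3) Perturbation of $\theta$ (as in (2)), independent sampling: for each of the three differences $V=v_0(T)+O(\varepsilon)$ and $V=O(1)$, where $$v_0(T)=2\sigma^2T^{-1}\theta^{-2}-3\sigma^2T^{-2}\theta^{-3}+4\sigma^2T^{-2}\theta^{-3}e^{-T\theta}-\sigma^2T^{-2}\theta^{-3}e^{-2T\theta}.$$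 (4) Perturbation of $\sigma$ ($\theta_1=\theta_2=\theta$, $|\varepsilon|<\sigma$), common random paths: $$V=\varepsilon^2\big(c\,T^{-1}\theta^{-2}+O(T^{-2})\big),$$ with $c=4$ for the central difference and $c=1$ for the forward and backward differences; here the $O(T^{-2})$ term depends only on $\theta$, $T$ and the difference used, and its constant only on $\theta$. (5) Perturbation of $\sigma$ (as in (4), constants depending only on $\theta,\sigma$), independent sampling: for the central difference $$V=2\sigma^2T^{-1}\theta^{-2}+2\varepsilon^2T^{-1}\theta^{-2}+O(T^{-2})(1+\varepsilon^2),$$ and for each of the three differences $V=v_0(T)+O(\varepsilon)$ and $V=O(1)$. -/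

import Mathlib

open MeasureTheory ProbabilityTheory
open scoped NNReal

universe u

/-- `X` is an Ornstein-Uhlenbeck process with parameters `θ`, `μ`, `σ`, deterministic initial
value `x₀`, driven by `W`: almost surely its path is continuous and solves
`dX_t = θ (μ - X_t) dt + σ dW_t`, `X_0 = x₀`, in integrated form. Since the noise is additive
with constant coefficient, the stochastic integral in the equation is `σ W_t` and the equation
makes sense path by path. -/
structure IsOUProcess {Ω : Type u} [MeasurableSpace Ω] (θ μ σ x₀ : ℝ)
    (W X : ℝ≥0 → Ω → ℝ) (P : Measure Ω) : Prop where
  continuous_paths : ∀ᵐ ω ∂P, Continuous fun t : ℝ≥0 ↦ X t ω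
  integral_eq : ∀ᵐ ω ∂P, ∀ t : ℝ≥0,
    X t ω = x₀ + (∫ s in (0 : ℝ)..(t : ℝ), θ * (μ - X s.toNNReal ω)) + σ * W t ω

/-- Common random path coupling: `X₁`, `X₂` are OU processes with the same `μ`, `x₀`
and parameters `(θ₁, σ₁)`, `(θ₂, σ₂)`, driven by one and the same Brownian motion. -/
def IsCommonPathOU {Ω : Type u} [MeasurableSpace Ω] (θ₁ θ₂ σ₁ σ₂ μ x₀ : ℝ)
    (X₁ X₂ : ℝ≥0 → Ω → ℝ) (P : Measure Ω) : Prop :=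
  ∃ W : ℝ≥0 → Ω → ℝ, IsBrownianReal W P ∧
    IsOUProcess θ₁ μ σ₁ x₀ W X₁ P ∧ IsOUProcess θ₂ μ σ₂ x₀ W X₂ P

/-- Independent sampling: `X₁`, `X₂` are OU processes with the same `μ`, `x₀`
and parameters `(θ₁, σ₁)`, `(θ₂, σ₂)`, driven by two independent Brownian motions. -/
def IsIndependentOU {Ω : Type u} [MeasurableSpace Ω] (θ₁ θ₂ σ₁ σ₂ μ x₀ : ℝ)
    (X₁ X₂ : ℝ≥0 → Ω → ℝ) (P : Measure Ω) : Prop :=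
  ∃ W₁ W₂ : ℝ≥0 → Ω → ℝ, IsBrownianReal W₁ P ∧ IsBrownianReal W₂ P ∧
    IndepFun (fun ω t ↦ W₁ t ω) (fun ω t ↦ W₂ t ω) P ∧
    IsOUProcess θ₁ μ σ₁ x₀ W₁ X₁ P ∧ IsOUProcess θ₂ μ σ₂ x₀ W₂ X₂ P

/-- The time average `T⁻¹ ∫_0^T X_s ds`. -/
noncomputable def timeAverage {Ω : Type u} (T : ℝ) (X : ℝ≥0 → Ω → ℝ) (ω : Ω) : ℝ :=
  T⁻¹ * ∫ s in (0 : ℝ)..T, X s.toNNReal ω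

/-- The variance of the difference of the two time averages. -/
noncomputable def varDiff {Ω : Type u} [MeasurableSpace Ω] (T : ℝ) (X₁ X₂ : ℝ≥0 → Ω → ℝ)
    (P : Measure Ω) : ℝ :=
  Var[fun ω ↦ timeAverage T X₁ ω - timeAverage T X₂ ω; P]

/-- The standard first order differences. -/
inductive DiffScheme : Type where
  | central : DiffScheme
  | forward : DiffScheme
  | backward : DiffScheme

/-- The first parameter value of a difference at `p` with step `ε`. -/
def DiffScheme.upper (d : DiffScheme) (p ε : ℝ) : ℝ :=
  match d with
  | DiffScheme.central => p + ε
  | DiffScheme.forward => p + ε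
  | DiffScheme.backward => p

/-- The second parameter value of a difference at `p` with step `ε`. -/
def DiffScheme.lower (d : DiffScheme) (p ε : ℝ) : ℝ :=
  match d with
  | DiffScheme.central => p - ε
  | DiffScheme.forward => p
  | DiffScheme.backward => p - ε

/-- `2 σ² T⁻¹ θ⁻² - 3 σ² T⁻² θ⁻³ + 4 σ² T⁻² θ⁻³ e^{-Tθ} - σ² T⁻² θ⁻³ e^{-2Tθ}`, the value of the
variance of the difference at `ε = 0` under independent sampling. -/
noncomputable def indepLeading (θ σ T : ℝ) : ℝ :=
  2 * σ ^ 2 / (T * θ ^ 2) - 3 * σ ^ 2 / (T ^ 2 * θ ^ 3)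
    + 4 * σ ^ 2 / (T ^ 2 * θ ^ 3) * Real.exp (-(T * θ))
    - σ ^ 2 / (T ^ 2 * θ ^ 3) * Real.exp (-(2 * T * θ))

/-! Additive noise makes everything pathwise: `I(t) = ∫_0^t X` satisfies `I' = x₀ + θμt - θI + σW`,
so the integrating factor `e^{-θ(T-t)}` gives `I(T)` as a deterministic number plus `σ ∫_0^T
e^{-θ(T-s)} W_s ds` (`integral_of_path_eq`). Hence `μ` and `x₀` drop out of every covariance.

With `g_a(u) = ∫_0^u e^{-av} dv`, Fubini and `E[W_s W_t] = min s t` turn the covariance of two such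
noises on one Brownian motion into `⟨g_{θ₁}, g_{θ₂}⟩` in `L²(0,T)` (`memLp_ouNoise_and_covariance`,
`integral_integral_exp_mul_min`); independent noises have covariance 0. So `T² V` is `‖σ₁ g_{θ₁} -
σ₂ g_{θ₂}‖²` for common paths and `σ₁² ‖g_{θ₁}‖² + σ₂² ‖g_{θ₂}‖²` for independent ones.

The rest is deterministic analysis. Since `⟨g_a, g_b⟩ = T/(ab) + O(1)`, division by `T²` leaves
`O(T⁻²)`. Bounds uniform down to `T = 0` need the integral to be `O(T²)`: one factor of the
integrand is bounded uniformly in `u`, the other by a multiple of `u` (`abs_integral_le_mul_sq`).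
For the central difference in `θ`, `g_{θ+ε} - g_{θ-ε} = -2εh + O(ε³)` with `h = expIntDeriv θ`, and
`‖h‖² = T/θ⁴ + O(1)`. -/

/-! ### Pointwise estimates for the integrated kernel and its dependence on the rate. -/

/-- The function `u ↦ ∫_0^u e^{-av} dv`, the time integral of the OU kernel. -/
noncomputable def expInt (a u : ℝ) : ℝ := ∫ v in (0 : ℝ)..u, Real.exp (-(a * v))

/-- The inner product of `expInt a` and `expInt b` in `L²(0, T)`. -/
noncomputable def expIntInner (a b T : ℝ) : ℝ := ∫ u in (0 : ℝ)..T, expInt a u * expInt b u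

/-- The function `u ↦ ∫_0^u v e^{-av} dv`, the negative of the derivative of `expInt` in `a`. -/
noncomputable def expIntDeriv (a u : ℝ) : ℝ := ∫ v in (0 : ℝ)..u, v * Real.exp (-(a * v))

lemma continuous_expInt (a : ℝ) : Continuous (expInt a) :=
  intervalIntegral.continuous_primitive (fun _ _ ↦ (by fun_prop : Continuous _).intervalIntegrable _ _) 0

lemma continuous_expIntDeriv (a : ℝ) : Continuous (expIntDeriv a) :=
  intervalIntegral.continuous_primitive (fun _ _ ↦ (by fun_prop : Continuous _).intervalIntegrable _ _) 0

lemma hasDerivAt_exp_neg_mul (a u : ℝ) :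
    HasDerivAt (fun v ↦ Real.exp (-(a * v))) (-a * Real.exp (-(a * u))) u := by
  have h : HasDerivAt (fun v ↦ -(a * v)) (-a) u := by
    simpa using ((hasDerivAt_id u).const_mul a).fun_neg
  rw [mul_comm]
  exact h.exp

lemma expInt_eq {a : ℝ} (ha : a ≠ 0) (u : ℝ) : expInt a u = (1 - Real.exp (-(a * u))) / a := by
  have h : ∀ x ∈ Set.uIcc 0 u,
      HasDerivAt (fun v ↦ -Real.exp (-(a * v)) / a) (Real.exp (-(a * x))) x := fun x _ ↦ by
    convert! (hasDerivAt_exp_neg_mul a x).neg.div_const a using 1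
    field_simp
  rw [expInt, intervalIntegral.integral_eq_sub_of_hasDerivAt h
    ((by fun_prop : Continuous _).intervalIntegrable _ _)]
  simp
  ring

lemma expIntDeriv_eq {a : ℝ} (ha : a ≠ 0) (u : ℝ) :
    expIntDeriv a u = 1 / a ^ 2 - (u / a + 1 / a ^ 2) * Real.exp (-(a * u)) := by
  have h : ∀ x ∈ Set.uIcc 0 u,
      HasDerivAt (fun v ↦ -((v / a + 1 / a ^ 2) * Real.exp (-(a * v))))
        (x * Real.exp (-(a * x))) x := fun x _ ↦ by
    convert! ((((hasDerivAt_id x).div_const a).add_const (1 / a ^ 2)).mul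
      (hasDerivAt_exp_neg_mul a x)).neg using 1
    simp only [id]
    field_simp
    ring
  rw [expIntDeriv, intervalIntegral.integral_eq_sub_of_hasDerivAt h
    ((by fun_prop : Continuous _).intervalIntegrable _ _)]
  simp
  ring

lemma expInt_nonneg (a : ℝ) {u : ℝ} (hu : 0 ≤ u) : 0 ≤ expInt a u :=
  intervalIntegral.integral_nonneg hu fun _ _ ↦ (Real.exp_pos _).le

lemma expInt_le_inv {a : ℝ} (ha : 0 < a) (u : ℝ) : expInt a u ≤ 1 / a := by
  rw [expInt_eq ha.ne']
  gcongr
  linarith [Real.exp_pos (-(a * u))]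

/-- A function dominated by `K e^{-cv}` on `[0, u]` has integral at most `K u`. -/
lemma abs_integral_le_mul_of_exp_bound {f : ℝ → ℝ} {K c u : ℝ} (hK : 0 ≤ K) (hc : 0 < c)
    (hu : 0 ≤ u) (hf : ∀ v, 0 ≤ v → |f v| ≤ K * Real.exp (-(c * v))) :
    |∫ v in (0 : ℝ)..u, f v| ≤ K * u := by
  have h := intervalIntegral.norm_integral_le_of_norm_le_const (a := 0) (b := u) (f := f) (C := K)
    fun v hv ↦ by
      rw [Set.uIoc_of_le hu] at hv
      refine (hf v hv.1.le).trans (mul_le_of_le_one_right hK ?_)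
      rw [Real.exp_le_one_iff]
      nlinarith [hv.1]
  simpa [abs_of_nonneg hu] using h

/-- A function dominated by `K e^{-cv}` on `[0, u]` has integral at most `K / c`. -/
lemma abs_integral_le_div_of_exp_bound {f : ℝ → ℝ} {K c u : ℝ} (hK : 0 ≤ K) (hc : 0 < c)
    (hu : 0 ≤ u) (hf : ∀ v, 0 ≤ v → |f v| ≤ K * Real.exp (-(c * v))) :
    |∫ v in (0 : ℝ)..u, f v| ≤ K / c := by
  have h := intervalIntegral.norm_integral_le_of_norm_le (μ := volume) (f := f) hu
    (Filter.Eventually.of_forall fun v hv ↦ hf v hv.1.le)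
    ((by fun_prop : Continuous _).intervalIntegrable _ _)
  rw [intervalIntegral.integral_const_mul] at h
  refine h.trans ?_
  have := mul_le_mul_of_nonneg_left (expInt_le_inv hc u) hK
  rw [expInt] at this
  linarith [mul_one_div K c]

lemma expInt_le_self {a : ℝ} (ha : 0 < a) {u : ℝ} (hu : 0 ≤ u) : expInt a u ≤ u := by
  have := abs_integral_le_mul_of_exp_bound (f := fun v ↦ Real.exp (-(a * v))) zero_le_one ha hu
    fun v _ ↦ by simp
  exact (le_abs_self _).trans (by simpa [expInt] using this)

/-- Half of the decay rate absorbs the power: `x ≤ e^x` at `x = cv/(2n)`, raised to the `n`-th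
power, costs exactly `e^{cv/2}`. -/
lemma pow_mul_exp_neg_le {c : ℝ} (hc : 0 < c) (n : ℕ) {v : ℝ} (hv : 0 ≤ v) :
    v ^ n * Real.exp (-(c * v)) ≤ (2 * n / c) ^ n * Real.exp (-(c / 2 * v)) := by
  rcases Nat.eq_zero_or_pos n with rfl | hn
  · simp only [pow_zero, one_mul]
    exact Real.exp_le_exp.2 (by nlinarith)
  have hn' : (0 : ℝ) < n := by exact_mod_cast hn
  have h1 : c * v / (2 * n) ≤ Real.exp (c * v / (2 * n)) :=
    (by linarith : _ ≤ c * v / (2 * n) + 1).trans (Real.add_one_le_exp _)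
  have h2 : v ≤ 2 * n / c * Real.exp (c * v / (2 * n)) := by
    calc v = 2 * n / c * (c * v / (2 * n)) := by field_simp
      _ ≤ _ := by gcongr
  calc v ^ n * Real.exp (-(c * v))
      ≤ (2 * n / c * Real.exp (c * v / (2 * n))) ^ n * Real.exp (-(c * v)) := by gcongr
    _ = (2 * n / c) ^ n * Real.exp (-(c / 2 * v)) := by
        rw [mul_pow, ← Real.exp_nat_mul, mul_assoc, ← Real.exp_add]
        congr 2
        field_simp
        ring

/-- For `a ≤ b` the difference is `e^{-av}(1 - e^{-(b-a)v})`, and `1 - e^{-x} ≤ x`. -/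
lemma abs_exp_sub_exp_le {a b c v : ℝ} (ha : c ≤ a) (hb : c ≤ b) (hv : 0 ≤ v) :
    |Real.exp (-(a * v)) - Real.exp (-(b * v))| ≤ |a - b| * (v * Real.exp (-(c * v))) := by
  wlog hab : a ≤ b generalizing a b
  · rw [abs_sub_comm, abs_sub_comm a]
    exact this hb ha (le_of_not_ge hab)
  have h1 : Real.exp (-(b * v)) ≤ Real.exp (-(a * v)) := Real.exp_le_exp.2 (by nlinarith)
  have h2 : Real.exp (-(a * v)) ≤ Real.exp (-(c * v)) := Real.exp_le_exp.2 (by nlinarith)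
  have h3 : Real.exp (-(b * v)) = Real.exp (-(a * v)) * Real.exp (-((b - a) * v)) := by
    rw [← Real.exp_add]; ring_nf
  have h4 := Real.add_one_le_exp (-((b - a) * v))
  rw [abs_of_nonneg (by linarith), abs_of_nonpos (by linarith), h3]
  have h5 : 0 ≤ (b - a) * v := mul_nonneg (by linarith) hv
  nlinarith [Real.exp_pos (-(a * v))]

/-- The even Taylor terms of `e^x` and `e^{-x}` cancel, so only the two cubic remainders survive. -/
lemma abs_exp_neg_sub_exp_add_le (x : ℝ) :
    |Real.exp (-x) - Real.exp x + 2 * x| ≤ 2 * |x| ^ 3 * Real.exp |x| := by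
  have key : ∀ y : ℝ, |Real.exp y - (1 + y + y ^ 2 / 2)| ≤ |y| ^ 3 * Real.exp |y| := fun y ↦ by
    have := Complex.norm_exp_sub_sum_le_norm_mul_exp (y : ℂ) 3
    simp only [Finset.sum_range_succ, Finset.sum_range_zero] at this
    norm_num [Nat.factorial] at this
    rw [← Real.norm_eq_abs, ← Complex.norm_real]
    push_cast
    simpa using this
  have h1 := abs_le.1 (key x)
  have h2 := abs_le.1 (key (-x))
  rw [abs_neg] at h2
  rw [abs_le]
  constructor <;> nlinarith

lemma expInt_sub_expInt (a b u : ℝ) :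
    expInt a u - expInt b u
      = ∫ v in (0 : ℝ)..u, (Real.exp (-(a * v)) - Real.exp (-(b * v))) := by
  rw [expInt, expInt, intervalIntegral.integral_sub] <;>
    exact (by fun_prop : Continuous _).intervalIntegrable _ _

lemma abs_exp_sub_exp_le' {a b c v : ℝ} (hc : 0 < c) (ha : c ≤ a) (hb : c ≤ b) (hv : 0 ≤ v) :
    |Real.exp (-(a * v)) - Real.exp (-(b * v))|
      ≤ (2 / c * |a - b|) * Real.exp (-(c / 2 * v)) := by
  have := pow_mul_exp_neg_le hc 1 hv
  simp only [pow_one, Nat.cast_one, mul_one] at this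
  calc _ ≤ _ := abs_exp_sub_exp_le ha hb hv
    _ ≤ |a - b| * (2 / c * Real.exp (-(c / 2 * v))) := by gcongr
    _ = _ := by ring

/-- This bound is linear in `u`, and `abs_expInt_sub_le` is uniform in `u`; their product gives the
`O(u)` integrands that produce `T²`. -/
lemma abs_expInt_sub_le_mul {a b c u : ℝ} (hc : 0 < c) (ha : c ≤ a) (hb : c ≤ b) (hu : 0 ≤ u) :
    |expInt a u - expInt b u| ≤ 2 / c * |a - b| * u := by
  rw [expInt_sub_expInt]
  exact abs_integral_le_mul_of_exp_bound (by positivity) (half_pos hc) hu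
    fun v hv ↦ abs_exp_sub_exp_le' hc ha hb hv

lemma abs_expInt_sub_le {a b c u : ℝ} (hc : 0 < c) (ha : c ≤ a) (hb : c ≤ b) (hu : 0 ≤ u) :
    |expInt a u - expInt b u| ≤ 4 / c ^ 2 * |a - b| := by
  rw [expInt_sub_expInt]
  refine (abs_integral_le_div_of_exp_bound (by positivity) (half_pos hc) hu
    fun v hv ↦ abs_exp_sub_exp_le' hc ha hb hv).trans_eq ?_
  field_simp
  ring

lemma expIntDeriv_nonneg (a : ℝ) {u : ℝ} (hu : 0 ≤ u) : 0 ≤ expIntDeriv a u :=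
  intervalIntegral.integral_nonneg hu fun _ hv ↦ mul_nonneg hv.1 (Real.exp_pos _).le

lemma expIntDeriv_le {a u : ℝ} (ha : 0 < a) (hu : 0 ≤ u) : expIntDeriv a u ≤ 1 / a ^ 2 := by
  rw [expIntDeriv_eq ha.ne']
  have : 0 ≤ (u / a + 1 / a ^ 2) * Real.exp (-(a * u)) := by positivity
  linarith

lemma expIntDeriv_le_mul {a u : ℝ} (ha : 0 < a) (hu : 0 ≤ u) : expIntDeriv a u ≤ 2 / a * u := by
  refine (le_abs_self _).trans (abs_integral_le_mul_of_exp_bound (by positivity) (half_pos ha) hu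
    fun v hv ↦ ?_)
  have := pow_mul_exp_neg_le ha 1 hv
  simp only [pow_one, Nat.cast_one, mul_one] at this
  rwa [abs_of_nonneg (by positivity)]

/-- The third order error of the central difference of `expInt`. -/
lemma abs_expInt_central_sub_le {θ ε u : ℝ} (hθ : 0 < θ) (hε : |ε| ≤ θ / 2) (hu : 0 ≤ u) :
    |expInt (θ + ε) u - expInt (θ - ε) u + 2 * ε * expIntDeriv θ u|
      ≤ 2 * (12 / θ) ^ 3 * (4 / θ) * |ε| ^ 3 := by
  have h : expInt (θ + ε) u - expInt (θ - ε) u + 2 * ε * expIntDeriv θ u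
      = ∫ v in (0 : ℝ)..u, (Real.exp (-((θ + ε) * v)) - Real.exp (-((θ - ε) * v))
          + 2 * ε * (v * Real.exp (-(θ * v)))) := by
    rw [expInt_sub_expInt, expIntDeriv, ← intervalIntegral.integral_const_mul,
      ← intervalIntegral.integral_add] <;>
      exact (by fun_prop : Continuous _).intervalIntegrable _ _
  rw [h]
  -- The factor `e^{|ε|v}` reduces the rate from `θ` to `θ/2`; absorbing `v³` halves it again to
  -- `θ/4`, at the cost of `(2·3/(θ/2))³ = (12/θ)³`.
  refine (abs_integral_le_div_of_exp_bound (K := 2 * (12 / θ) ^ 3 * |ε| ^ 3) (c := θ / 4)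
    (by positivity) (by positivity) hu fun v hv ↦ ?_).trans_eq ?_
  · have e1 : Real.exp (-((θ + ε) * v)) = Real.exp (-(θ * v)) * Real.exp (-(ε * v)) := by
      rw [← Real.exp_add]; ring_nf
    have e2 : Real.exp (-((θ - ε) * v)) = Real.exp (-(θ * v)) * Real.exp (ε * v) := by
      rw [← Real.exp_add]; ring_nf
    have e3 : Real.exp (-(θ * v)) * Real.exp |ε * v| ≤ Real.exp (-(θ / 2 * v)) := by
      rw [← Real.exp_add, abs_mul, abs_of_nonneg hv]
      exact Real.exp_le_exp.2 (by nlinarith)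
    have e4 := pow_mul_exp_neg_le (half_pos hθ) 3 hv
    calc |_| = Real.exp (-(θ * v))
          * |Real.exp (-(ε * v)) - Real.exp (ε * v) + 2 * (ε * v)| := by
          rw [e1, e2, ← abs_of_pos (Real.exp_pos (-(θ * v))), ← abs_mul,
            abs_of_pos (Real.exp_pos (-(θ * v)))]
          ring_nf
      _ ≤ Real.exp (-(θ * v)) * (2 * |ε * v| ^ 3 * Real.exp |ε * v|) := by
          gcongr
          exact abs_exp_neg_sub_exp_add_le _
      _ = 2 * |ε| ^ 3 * v ^ 3 * (Real.exp (-(θ * v)) * Real.exp |ε * v|) := by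
          rw [abs_mul, abs_of_nonneg hv]; ring
      _ ≤ 2 * |ε| ^ 3 * v ^ 3 * Real.exp (-(θ / 2 * v)) := by gcongr
      _ = 2 * |ε| ^ 3 * (v ^ 3 * Real.exp (-(θ / 2 * v))) := by ring
      _ ≤ _ := by
          refine (mul_le_mul_of_nonneg_left e4 (by positivity)).trans_eq ?_
          push_cast
          field_simp
          ring_nf
  · field_simp

/-! ### Inner products and squared norms on `[0, T]`. -/

/-- A function bounded by `K u` on `[0, T]` has integral at most `K T²`. -/
lemma abs_integral_le_mul_sq {f : ℝ → ℝ} {K T : ℝ} (hK : 0 ≤ K) (hT : 0 ≤ T)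
    (hf : ∀ u, 0 ≤ u → |f u| ≤ K * u) : |∫ u in (0 : ℝ)..T, f u| ≤ K * T ^ 2 := by
  have h := intervalIntegral.norm_integral_le_of_norm_le_const (a := 0) (b := T) (f := f)
    (C := K * T) fun v hv ↦ by
      rw [Set.uIoc_of_le hT] at hv
      exact (hf v hv.1.le).trans (by gcongr; exact hv.2)
  rw [sub_zero, abs_of_nonneg hT, Real.norm_eq_abs] at h
  linarith

lemma expIntInner_eq {a b : ℝ} (ha : 0 < a) (hb : 0 < b) (T : ℝ) :
    expIntInner a b T = (T - expInt a T - expInt b T + expInt (a + b) T) / (a * b) := by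
  have h : ∀ u, expInt a u * expInt b u
      = (1 - Real.exp (-(a * u)) - Real.exp (-(b * u)) + Real.exp (-((a + b) * u))) / (a * b) := by
    intro u
    have : Real.exp (-((a + b) * u)) = Real.exp (-(a * u)) * Real.exp (-(b * u)) := by
      rw [← Real.exp_add]; ring_nf
    rw [expInt_eq ha.ne', expInt_eq hb.ne', this]
    field_simp
    ring
  simp only [expIntInner, h]
  rw [intervalIntegral.integral_div, intervalIntegral.integral_add, intervalIntegral.integral_sub,
    intervalIntegral.integral_sub]
  · simp [expInt]
  all_goals exact (by fun_prop : Continuous _).intervalIntegrable _ _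

lemma abs_expIntInner_sub_le {a b T : ℝ} (ha : 0 < a) (hb : 0 < b) (hT : 0 ≤ T) :
    |expIntInner a b T - T / (a * b)| ≤ (1 / a + 1 / b + 1 / (a + b)) / (a * b) := by
  have hab := add_pos ha hb
  rw [expIntInner_eq ha hb, ← sub_div, abs_div, abs_of_pos (mul_pos ha hb)]
  gcongr
  rw [abs_le]
  constructor <;> linarith [expInt_nonneg a hT, expInt_nonneg b hT, expInt_nonneg (a + b) hT,
    expInt_le_inv ha T, expInt_le_inv hb T, expInt_le_inv hab T, one_div_pos.2 ha,
    one_div_pos.2 hb, one_div_pos.2 hab]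

lemma expIntInner_self_nonneg (a : ℝ) {T : ℝ} (hT : 0 ≤ T) : 0 ≤ expIntInner a a T :=
  intervalIntegral.integral_nonneg hT fun _ _ ↦ mul_self_nonneg _

lemma expIntInner_self_le {a T : ℝ} (ha : 0 < a) (hT : 0 ≤ T) :
    expIntInner a a T ≤ 1 / a * T ^ 2 :=
  (le_abs_self _).trans <| abs_integral_le_mul_sq (by positivity) hT fun u hu ↦ by
    have h0 := expInt_nonneg a hu
    rw [abs_of_nonneg (mul_nonneg h0 h0)]
    exact mul_le_mul (expInt_le_inv ha u) (expInt_le_self ha hu) h0 (by positivity)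

lemma expIntInner_self_sub_add (a b T : ℝ) :
    expIntInner a a T - 2 * expIntInner a b T + expIntInner b b T
      = ∫ u in (0 : ℝ)..T, (expInt a u - expInt b u) ^ 2 := by
  have ha := continuous_expInt a
  have hb := continuous_expInt b
  rw [expIntInner, expIntInner, expIntInner, ← intervalIntegral.integral_const_mul,
    ← intervalIntegral.integral_sub, ← intervalIntegral.integral_add]
  · congr 1; ext u; ring
  all_goals exact (by fun_prop : Continuous _).intervalIntegrable _ _

/-- Difference of squares: the sum is at most `2/c`, the difference is linear in `u`. -/
lemma abs_expIntInner_self_sub_le {a b c T : ℝ} (hc : 0 < c) (ha : c ≤ a) (hb : c ≤ b)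
    (hT : 0 ≤ T) :
    |expIntInner a a T - expIntInner b b T| ≤ 4 / c ^ 2 * |a - b| * T ^ 2 := by
  have ha' := continuous_expInt a
  have hb' := continuous_expInt b
  rw [expIntInner, expIntInner, ← intervalIntegral.integral_sub]
  · refine abs_integral_le_mul_sq (by positivity) hT fun u hu ↦ ?_
    have ha0 := hc.trans_le ha
    have hb0 := hc.trans_le hb
    have h1 : |expInt a u + expInt b u| ≤ 2 / c := by
      rw [abs_of_nonneg (add_nonneg (expInt_nonneg a hu) (expInt_nonneg b hu))]
      have := one_div_le_one_div_of_le hc ha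
      have := one_div_le_one_div_of_le hc hb
      have : 2 / c = 1 / c + 1 / c := by ring
      linarith [expInt_le_inv ha0 u, expInt_le_inv hb0 u]
    calc |_| = |expInt a u + expInt b u| * |expInt a u - expInt b u| := by
          rw [← abs_mul]; ring_nf
      _ ≤ 2 / c * (2 / c * |a - b| * u) :=
          mul_le_mul h1 (abs_expInt_sub_le_mul hc ha hb hu) (abs_nonneg _) (by positivity)
      _ = _ := by ring
  all_goals exact (by fun_prop : Continuous _).intervalIntegrable _ _

lemma integral_sq_expInt_sub_le {a b c T : ℝ} (hc : 0 < c) (ha : c ≤ a) (hb : c ≤ b)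
    (hT : 0 ≤ T) :
    ∫ u in (0 : ℝ)..T, (expInt a u - expInt b u) ^ 2 ≤ 8 / c ^ 3 * |a - b| ^ 2 * T ^ 2 := by
  refine (le_abs_self _).trans <| abs_integral_le_mul_sq (by positivity) hT fun u hu ↦ ?_
  calc |_| = |expInt a u - expInt b u| * |expInt a u - expInt b u| := by
        rw [← abs_mul]; ring_nf
    _ ≤ (4 / c ^ 2 * |a - b|) * (2 / c * |a - b| * u) :=
        mul_le_mul (abs_expInt_sub_le hc ha hb hu) (abs_expInt_sub_le_mul hc ha hb hu)
          (abs_nonneg _) (by positivity)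
    _ = _ := by field_simp; ring

/-- `expIntDeriv θ u` tends to `1/θ²` exponentially fast, so the error in its square has an integral
bounded independently of `T`. -/
lemma exists_abs_integral_sq_expIntDeriv_sub_le {θ : ℝ} (hθ : 0 < θ) :
    ∃ C, ∀ T, 0 ≤ T → |(∫ u in (0 : ℝ)..T, expIntDeriv θ u ^ 2) - T / θ ^ 4| ≤ C := by
  refine ⟨(2 / θ ^ 2 * (2 / θ ^ 2 + 1 / θ ^ 2)) / (θ / 2), fun T hT ↦ ?_⟩
  have hc := continuous_expIntDeriv θ
  have h : (∫ u in (0 : ℝ)..T, expIntDeriv θ u ^ 2) - T / θ ^ 4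
      = ∫ u in (0 : ℝ)..T, (expIntDeriv θ u ^ 2 - 1 / θ ^ 4) := by
    rw [intervalIntegral.integral_sub]
    · simp [div_eq_mul_inv]
    all_goals exact (by fun_prop : Continuous _).intervalIntegrable _ _
  rw [h]
  refine abs_integral_le_div_of_exp_bound (by positivity) (half_pos hθ) hT fun u hu ↦ ?_
  have h0 := expIntDeriv_nonneg θ hu
  have h1 := expIntDeriv_le hθ hu
  have h2 : |expIntDeriv θ u + 1 / θ ^ 2| ≤ 2 / θ ^ 2 := by
    rw [abs_of_nonneg (add_nonneg h0 (by positivity))]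
    have : 2 / θ ^ 2 = 1 / θ ^ 2 + 1 / θ ^ 2 := by ring
    linarith
  have h3 : |expIntDeriv θ u - 1 / θ ^ 2|
      ≤ (2 / θ ^ 2 + 1 / θ ^ 2) * Real.exp (-(θ / 2 * u)) := by
    have p1 := pow_mul_exp_neg_le hθ 1 hu
    simp only [pow_one, Nat.cast_one, mul_one] at p1
    have p0 : Real.exp (-(θ * u)) ≤ Real.exp (-(θ / 2 * u)) := Real.exp_le_exp.2 (by nlinarith)
    calc |expIntDeriv θ u - 1 / θ ^ 2|
        = 1 / θ * (u * Real.exp (-(θ * u))) + 1 / θ ^ 2 * Real.exp (-(θ * u)) := by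
          rw [abs_of_nonpos (by linarith), expIntDeriv_eq hθ.ne']; ring
      _ ≤ 1 / θ * (2 / θ * Real.exp (-(θ / 2 * u))) + 1 / θ ^ 2 * Real.exp (-(θ / 2 * u)) := by
          gcongr
      _ = _ := by field_simp
  calc |_| = |expIntDeriv θ u + 1 / θ ^ 2| * |expIntDeriv θ u - 1 / θ ^ 2| := by
        rw [← abs_mul]; ring_nf
    _ ≤ 2 / θ ^ 2 * ((2 / θ ^ 2 + 1 / θ ^ 2) * Real.exp (-(θ / 2 * u))) :=
        mul_le_mul h2 h3 (abs_nonneg _) (by positivity)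
    _ = _ := by ring

/-- Write the integrand as `(A + 2εh)(A - 2εh)`, with `A` the central difference and `h =
expIntDeriv θ`. The first factor is `O(|ε|³)` uniformly in `u`, the second `O(|ε| u)`. -/
lemma exists_abs_integral_sq_central_sub_le {θ : ℝ} (hθ : 0 < θ) :
    ∃ C, 0 ≤ C ∧ ∀ T ε, 0 ≤ T → |ε| ≤ θ / 2 →
      |(∫ u in (0 : ℝ)..T, (expInt (θ + ε) u - expInt (θ - ε) u) ^ 2)
        - 4 * ε ^ 2 * ∫ u in (0 : ℝ)..T, expIntDeriv θ u ^ 2| ≤ C * ε ^ 4 * T ^ 2 := by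
  refine ⟨2 * (12 / θ) ^ 3 * (4 / θ) * (8 / θ + 4 / θ), by positivity, fun T ε hT hε ↦ ?_⟩
  have c1 := continuous_expInt (θ + ε)
  have c2 := continuous_expInt (θ - ε)
  have c3 := continuous_expIntDeriv θ
  have hb := abs_le.1 hε
  rw [← intervalIntegral.integral_const_mul, ← intervalIntegral.integral_sub]
  · refine abs_integral_le_mul_sq (by positivity) hT fun u hu ↦ ?_
    have h1 := abs_expInt_central_sub_le hθ hε hu
    have h2 : |expInt (θ + ε) u - expInt (θ - ε) u - 2 * ε * expIntDeriv θ u|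
        ≤ (8 / θ + 4 / θ) * |ε| * u := by
      have p1 := abs_expInt_sub_le_mul (a := θ + ε) (b := θ - ε) (half_pos hθ) (by linarith)
        (by linarith) hu
      have p2 : |2 * ε * expIntDeriv θ u| ≤ 4 / θ * |ε| * u := by
        rw [abs_mul, abs_mul, abs_of_nonneg (expIntDeriv_nonneg θ hu), abs_two]
        have := mul_le_mul_of_nonneg_left (expIntDeriv_le_mul hθ hu)
          (by positivity : 0 ≤ 2 * |ε|)
        refine this.trans_eq ?_
        ring
      have p3 : 2 / (θ / 2) * |θ + ε - (θ - ε)| * u = 8 / θ * |ε| * u := by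
        rw [show θ + ε - (θ - ε) = 2 * ε by ring, abs_mul, abs_two]
        field_simp
        ring
      refine (abs_sub _ _).trans ?_
      linarith
    have h4 : ε ^ 4 = |ε| ^ 3 * |ε| := by
      rw [← pow_succ]
      exact (Even.pow_abs (by decide) ε).symm
    calc |_| = |expInt (θ + ε) u - expInt (θ - ε) u + 2 * ε * expIntDeriv θ u|
          * |expInt (θ + ε) u - expInt (θ - ε) u - 2 * ε * expIntDeriv θ u| := by
          rw [← abs_mul]; ring_nf
      _ ≤ (2 * (12 / θ) ^ 3 * (4 / θ) * |ε| ^ 3) * ((8 / θ + 4 / θ) * |ε| * u) :=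
          mul_le_mul h1 h2 (abs_nonneg _) (by positivity)
      _ = _ := by rw [h4]; ring
  all_goals exact (by fun_prop : Continuous _).intervalIntegrable _ _

/-! ### Reduction of double integrals over `min s t` to single integrals. -/

/-- Split at `s`. Integrating by parts on `[0, s]`, with the tail integral of `q` as second
primitive, gives a boundary term that cancels the contribution of `[s, T]`. -/
lemma integral_mul_primitive_min {q k : ℝ → ℝ} (hq : Continuous q) (hk : Continuous k)
    {s T : ℝ} (hs : 0 ≤ s) (hsT : s ≤ T) :
    ∫ t in (0 : ℝ)..T, q t * ∫ r in (0 : ℝ)..(min s t), k r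
      = ∫ r in (0 : ℝ)..s, k r * ∫ t in r..T, q t := by
  have hK : Continuous fun t ↦ ∫ r in (0 : ℝ)..t, k r :=
    intervalIntegral.continuous_primitive (fun _ _ ↦ hk.intervalIntegrable _ _) 0
  have hKm : Continuous fun t ↦ ∫ r in (0 : ℝ)..(min s t), k r :=
    hK.comp (continuous_const.min continuous_id)
  have hi : ∀ a b, IntervalIntegrable (fun t ↦ q t * ∫ r in (0 : ℝ)..(min s t), k r) volume a b :=
    fun _ _ ↦ (hq.mul hKm).intervalIntegrable _ _
  have h1 : ∫ t in (0 : ℝ)..s, q t * ∫ r in (0 : ℝ)..(min s t), k r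
      = ∫ t in (0 : ℝ)..s, q t * ∫ r in (0 : ℝ)..t, k r :=
    intervalIntegral.integral_congr fun t ht ↦ by
      rw [Set.uIcc_of_le hs] at ht
      simp only [min_eq_right ht.2]
  have h2 : ∫ t in s..T, q t * ∫ r in (0 : ℝ)..(min s t), k r
      = (∫ t in s..T, q t) * ∫ r in (0 : ℝ)..s, k r := by
    rw [← intervalIntegral.integral_mul_const]
    refine intervalIntegral.integral_congr fun t ht ↦ ?_
    rw [Set.uIcc_of_le hsT] at ht
    simp only [min_eq_left ht.1]
  have hu : ∀ x ∈ Set.uIcc 0 s, HasDerivAt (fun t ↦ ∫ r in (0 : ℝ)..t, k r) (k x) x := fun x _ ↦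
    intervalIntegral.integral_hasDerivAt_right (hk.intervalIntegrable _ _)
      (hk.stronglyMeasurableAtFilter _ _) hk.continuousAt
  have hv : ∀ x ∈ Set.uIcc 0 s, HasDerivAt (fun r ↦ ∫ t in r..T, q t) (-q x) x := fun x _ ↦
    intervalIntegral.integral_hasDerivAt_left (hq.intervalIntegrable _ _)
      (hq.stronglyMeasurableAtFilter _ _) hq.continuousAt
  have h3 := intervalIntegral.integral_mul_deriv_eq_deriv_mul hu hv (hk.intervalIntegrable _ _)
    (hq.neg.intervalIntegrable _ _)
  simp only [mul_neg, intervalIntegral.integral_neg, intervalIntegral.integral_same, zero_mul,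
    sub_zero] at h3
  rw [← intervalIntegral.integral_add_adjacent_intervals (hi 0 s) (hi s T), h1, h2]
  simp only [mul_comm (q _)]
  linarith [mul_comm (∫ t in s..T, q t) (∫ r in (0 : ℝ)..s, k r)]

lemma integral_integral_mul_primitive_min {p q k : ℝ → ℝ} (hp : Continuous p) (hq : Continuous q)
    (hk : Continuous k) {T : ℝ} (hT : 0 ≤ T) :
    ∫ t in (0 : ℝ)..T, q t * ∫ s in (0 : ℝ)..T, p s * ∫ r in (0 : ℝ)..(min s t), k r
      = ∫ r in (0 : ℝ)..T, k r * (∫ s in r..T, p s) * ∫ t in r..T, q t := by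
  have hP : Continuous fun r ↦ ∫ s in r..T, p s := by
    simp_rw [intervalIntegral.integral_symm T]
    exact (intervalIntegral.continuous_primitive (fun _ _ ↦ hp.intervalIntegrable _ _) T).neg
  -- The one-variable identity is used twice: here in `t` with `s = T`, where `min T t = t`, and
  -- below in the inner variable.
  refine Eq.trans ?_ (integral_mul_primitive_min hq (hk.mul hP) hT le_rfl)
  refine intervalIntegral.integral_congr fun t ht ↦ ?_
  rw [Set.uIcc_of_le hT] at ht
  simp only [min_eq_right ht.2, Pi.mul_apply]
  rw [← integral_mul_primitive_min hp hk ht.1 ht.2]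
  simp only [min_comm t]

lemma integral_exp_neg_mul_sub (a r T : ℝ) :
    ∫ s in r..T, Real.exp (-(a * (T - s))) = expInt a (T - r) := by
  rw [intervalIntegral.integral_comp_sub_left (fun s ↦ Real.exp (-(a * s))), sub_self, expInt]

lemma integral_exp_neg_mul_shift (a r T : ℝ) :
    ∫ s in r..T, Real.exp (-(a * s)) = Real.exp (-(a * r)) * expInt a (T - r) := by
  have h := intervalIntegral.integral_comp_add_right (a := 0) (b := T - r)
    (fun s ↦ Real.exp (-(a * s))) r
  simp only [zero_add, sub_add_cancel] at h
  rw [← h, expInt, ← intervalIntegral.integral_const_mul]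
  congr 1; ext v
  rw [← Real.exp_add]; ring_nf

lemma integral_integral_exp_mul_min (a b : ℝ) {T : ℝ} (hT : 0 ≤ T) :
    ∫ t in (0 : ℝ)..T, ∫ s in (0 : ℝ)..T,
      Real.exp (-(a * (T - s))) * Real.exp (-(b * (T - t))) * min s t = expIntInner a b T := by
  have h := integral_integral_mul_primitive_min (p := fun s ↦ Real.exp (-(a * (T - s))))
    (q := fun s ↦ Real.exp (-(b * (T - s)))) (k := fun _ ↦ 1) (by fun_prop) (by fun_prop)
    (by fun_prop) hT
  simp only [integral_exp_neg_mul_sub, one_mul, intervalIntegral.integral_const, smul_eq_mul,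
    mul_one, sub_zero] at h
  rw [intervalIntegral.integral_comp_sub_left (fun r ↦ expInt a r * expInt b r), sub_self,
    sub_zero] at h
  rw [expIntInner, ← h]
  congr 1; ext t
  rw [← intervalIntegral.integral_const_mul]
  congr 1; ext s
  ring

/-- The weight `e^{(a+b)r}` cancels the factors `e^{-ar}`, `e^{-br}` of the tail integrals. The
value agrees with `integral_integral_exp_mul_min`, which identifies the covariance with the double
integral in the theorem. -/
lemma integral_integral_exp_mul_integral_exp (a b : ℝ) {T : ℝ} (hT : 0 ≤ T) :
    ∫ t in (0 : ℝ)..T, ∫ s in (0 : ℝ)..T, Real.exp (-a * s - b * t)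
      * ∫ r in (0 : ℝ)..(min s t), Real.exp ((a + b) * r) = expIntInner a b T := by
  have h := integral_integral_mul_primitive_min (p := fun s ↦ Real.exp (-(a * s)))
    (q := fun s ↦ Real.exp (-(b * s))) (k := fun r ↦ Real.exp ((a + b) * r)) (by fun_prop)
    (by fun_prop) (by fun_prop) hT
  simp only [integral_exp_neg_mul_shift] at h
  have h' : ∀ r, Real.exp ((a + b) * r) * (Real.exp (-(a * r)) * expInt a (T - r))
      * (Real.exp (-(b * r)) * expInt b (T - r)) = expInt a (T - r) * expInt b (T - r) := by
    intro r
    have : Real.exp ((a + b) * r) * Real.exp (-(a * r)) * Real.exp (-(b * r)) = 1 := by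
      rw [← Real.exp_add, ← Real.exp_add, ← Real.exp_zero]; ring_nf
    linear_combination (expInt a (T - r) * expInt b (T - r)) * this
  simp only [h'] at h
  rw [intervalIntegral.integral_comp_sub_left (fun r ↦ expInt a r * expInt b r), sub_self,
    sub_zero] at h
  rw [expIntInner, ← h]
  congr 1; ext t
  rw [← intervalIntegral.integral_const_mul]
  congr 1; ext s
  rw [← mul_assoc, ← Real.exp_add]
  ring_nf

lemma indepLeading_eq {θ σ T : ℝ} (hθ : 0 < θ) (hT : 0 < T) :
    indepLeading θ σ T = 2 * σ ^ 2 * (T ^ 2)⁻¹ * expIntInner θ θ T := by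
  have h : Real.exp (-(2 * T * θ)) = Real.exp (-((θ + θ) * T)) := by ring_nf
  rw [indepLeading, expIntInner_eq hθ hθ, expInt_eq hθ.ne', expInt_eq (by positivity : θ + θ ≠ 0),
    h, mul_comm T θ]
  field_simp
  ring

/-! ### Joint measurability and Fubini for time integrals. -/

/-- A process with almost surely continuous paths and a.e. measurable marginals agrees, up to a
null set, with a jointly measurable process all of whose paths are continuous. -/
lemma exists_measurable_continuous_modification {Ω : Type*} [MeasurableSpace Ω] {P : Measure Ω}
    {W : ℝ≥0 → Ω → ℝ} (hm : ∀ t, AEMeasurable (W t) P)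
    (hc : ∀ᵐ ω ∂P, Continuous fun t ↦ W t ω) :
    ∃ Z : ℝ≥0 → Ω → ℝ, Measurable (Function.uncurry Z) ∧ (∀ ω, Continuous fun t ↦ Z t ω) ∧
      ∀ᵐ ω ∂P, ∀ t, Z t ω = W t ω := by
  classical
  let D := TopologicalSpace.denseSeq ℝ≥0
  have hD : DenseRange D := TopologicalSpace.denseRange_denseSeq _
  have hae : ∀ᵐ ω ∂P, (Continuous fun t ↦ W t ω) ∧ ∀ n, W (D n) ω = (hm (D n)).mk _ ω :=
    hc.and (ae_all_iff.2 fun n ↦ (hm (D n)).ae_eq_mk)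
  -- The bad set is enlarged to a measurable null set, so that setting the process to 0 there
  -- preserves measurability.
  obtain ⟨N, hNsub, hN, hN0⟩ := exists_measurable_superset_of_null (ae_iff.1 hae)
  have hgood : ∀ ω ∉ N, (Continuous fun t ↦ W t ω) ∧ ∀ n, W (D n) ω = (hm (D n)).mk _ ω :=
    fun ω hω ↦ by
      by_contra h
      exact hω (hNsub h)
  let Z : ℝ≥0 → Ω → ℝ := fun t ω ↦ if ω ∈ N then 0 else W t ω
  have hZc : ∀ ω, Continuous fun t ↦ Z t ω := fun ω ↦ by
    by_cases hω : ω ∈ N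
    · simpa [Z, hω] using continuous_const
    · simpa [Z, hω] using (hgood ω hω).1
  have hZD : ∀ n, Measurable (Z (D n)) := fun n ↦ by
    have : Z (D n) = fun ω ↦ if ω ∈ N then 0 else (hm (D n)).mk _ ω := by
      ext ω
      by_cases hω : ω ∈ N
      · simp [Z, hω]
      · simp [Z, hω, (hgood ω hω).2 n]
    rw [this]
    exact Measurable.ite hN measurable_const (hm (D n)).measurable_mk
  -- Measurability passes from the countable dense set of times to every `t` by path continuity.
  have hZm : ∀ t, Measurable (Z t) := fun t ↦ by
    obtain ⟨x, hx, hxt⟩ := mem_closure_iff_seq_limit.1 (hD t)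
    choose n hn using hx
    refine measurable_of_tendsto_metrizable (fun k ↦ hZD (n k)) (tendsto_pi_nhds.2 fun ω ↦ ?_)
    simp only [hn]
    exact ((hZc ω).tendsto t).comp hxt
  refine ⟨Z, measurable_uncurry_of_continuous_of_measurable hZc hZm, hZc, ?_⟩
  filter_upwards [measure_eq_zero_iff_ae_notMem.1 hN0] with ω hω t
  simp [Z, hω]

section TimeIntegral

variable {Ω : Type*} [MeasurableSpace Ω] {P : Measure Ω} [IsProbabilityMeasure P]

/-- Fubini for the product of two weighted time integrals of second order processes. -/
lemma integrable_mul_timeIntegral {Z₁ Z₂ : ℝ → Ω → ℝ} {w₁ w₂ : ℝ → ℝ} {T K C : ℝ}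
    (hm₁ : Measurable (Function.uncurry Z₁)) (hm₂ : Measurable (Function.uncurry Z₂))
    (hw₁ : Continuous w₁) (hw₂ : Continuous w₂)
    (hC₁ : ∀ s ∈ Set.Ioc 0 T, |w₁ s| ≤ C) (hC₂ : ∀ s ∈ Set.Ioc 0 T, |w₂ s| ≤ C)
    (hZ₁ : ∀ s, MemLp (Z₁ s) 2 P) (hZ₂ : ∀ s, MemLp (Z₂ s) 2 P)
    (hK₁ : ∀ s ∈ Set.Ioc 0 T, ∫ ω, Z₁ s ω ^ 2 ∂P ≤ K)
    (hK₂ : ∀ s ∈ Set.Ioc 0 T, ∫ ω, Z₂ s ω ^ 2 ∂P ≤ K) :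
    Integrable (fun p : (ℝ × ℝ) × Ω ↦ w₁ p.1.1 * Z₁ p.1.1 p.2 * (w₂ p.1.2 * Z₂ p.1.2 p.2))
      (((volume.restrict (Set.Ioc 0 T)).prod (volume.restrict (Set.Ioc 0 T))).prod P) := by
  have hZ₁' : Measurable fun p : (ℝ × ℝ) × Ω ↦ Z₁ p.1.1 p.2 :=
    hm₁.comp (measurable_fst.fst.prodMk measurable_snd)
  have hZ₂' : Measurable fun p : (ℝ × ℝ) × Ω ↦ Z₂ p.1.2 p.2 :=
    hm₂.comp (measurable_fst.snd.prodMk measurable_snd)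
  have hF : Measurable
      fun p : (ℝ × ℝ) × Ω ↦ w₁ p.1.1 * Z₁ p.1.1 p.2 * (w₂ p.1.2 * Z₂ p.1.2 p.2) :=
    ((hw₁.measurable.comp measurable_fst.fst).mul hZ₁').mul
      ((hw₂.measurable.comp measurable_fst.snd).mul hZ₂')
  rw [integrable_prod_iff hF.aestronglyMeasurable]
  refine ⟨.of_forall fun p ↦ ?_, ?_⟩
  · exact ((hZ₁ p.1).const_mul (w₁ p.1)).integrable_mul ((hZ₂ p.2).const_mul (w₂ p.2))
  · refine Integrable.of_bound
      hF.norm.stronglyMeasurable.integral_prod_right'.aestronglyMeasurable (C * C * K) ?_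
    rw [Measure.prod_restrict]
    refine (ae_restrict_mem (measurableSet_Ioc.prod measurableSet_Ioc)).mono fun p hp ↦ ?_
    have hi : Integrable (fun ω ↦ Z₁ p.1 ω ^ 2) P := (hZ₁ p.1).integrable_sq
    have hi' : Integrable (fun ω ↦ Z₂ p.2 ω ^ 2) P := (hZ₂ p.2).integrable_sq
    have hC0 : 0 ≤ C := (abs_nonneg _).trans (hC₁ _ hp.1)
    rw [Real.norm_eq_abs, abs_of_nonneg (integral_nonneg fun _ ↦ norm_nonneg _)]
    calc ∫ ω, ‖w₁ p.1 * Z₁ p.1 ω * (w₂ p.2 * Z₂ p.2 ω)‖ ∂P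
        ≤ ∫ ω, C * C / 2 * (Z₁ p.1 ω ^ 2 + Z₂ p.2 ω ^ 2) ∂P := by
          refine integral_mono_of_nonneg (.of_forall fun _ ↦ norm_nonneg _)
            ((hi.add hi').const_mul _) (.of_forall fun ω ↦ ?_)
          have h1 : |w₁ p.1| * |w₂ p.2| ≤ C * C :=
            mul_le_mul (hC₁ _ hp.1) (hC₂ _ hp.2) (abs_nonneg _) hC0
          have h2 : |Z₁ p.1 ω| * |Z₂ p.2 ω| ≤ (Z₁ p.1 ω ^ 2 + Z₂ p.2 ω ^ 2) / 2 := by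
            rw [← sq_abs (Z₁ p.1 ω), ← sq_abs (Z₂ p.2 ω)]
            nlinarith [sq_nonneg (|Z₁ p.1 ω| - |Z₂ p.2 ω|)]
          have h3 := mul_le_mul h1 h2 (by positivity) (by positivity)
          simp only [norm_mul, Real.norm_eq_abs]
          linarith
      _ = C * C / 2 * (∫ ω, Z₁ p.1 ω ^ 2 ∂P + ∫ ω, Z₂ p.2 ω ^ 2 ∂P) := by
          rw [integral_const_mul, integral_add hi hi']
      _ ≤ C * C / 2 * (K + K) := by
          gcongr
          exacts [hK₁ _ hp.1, hK₂ _ hp.2]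
      _ = C * C * K := by ring

lemma aestronglyMeasurable_timeIntegral {Ω : Type*} [MeasurableSpace Ω] {P : Measure Ω}
    [SFinite P] {Z : ℝ → Ω → ℝ} {w : ℝ → ℝ}
    (hm : Measurable (Function.uncurry Z)) (hw : Continuous w) (T : ℝ) :
    AEStronglyMeasurable (fun ω ↦ ∫ s in Set.Ioc 0 T, w s * Z s ω) P := by
  have : Measurable fun p : Ω × ℝ ↦ w p.2 * Z p.2 p.1 :=
    (hw.measurable.comp measurable_snd).mul (hm.comp (measurable_snd.prodMk measurable_fst))
  exact this.stronglyMeasurable.integral_prod_right'.aestronglyMeasurable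

/-- The expected product of two weighted time integrals of second order processes. -/
lemma integral_mul_timeIntegral {Z₁ Z₂ : ℝ → Ω → ℝ} {w₁ w₂ : ℝ → ℝ} {T K : ℝ} (hT : 0 ≤ T)
    (hm₁ : Measurable (Function.uncurry Z₁)) (hm₂ : Measurable (Function.uncurry Z₂))
    (hw₁ : Continuous w₁) (hw₂ : Continuous w₂)
    (hZ₁ : ∀ s, MemLp (Z₁ s) 2 P) (hZ₂ : ∀ s, MemLp (Z₂ s) 2 P)
    (hK₁ : ∀ s ∈ Set.Ioc 0 T, ∫ ω, Z₁ s ω ^ 2 ∂P ≤ K)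
    (hK₂ : ∀ s ∈ Set.Ioc 0 T, ∫ ω, Z₂ s ω ^ 2 ∂P ≤ K) :
    Integrable (fun ω ↦ (∫ s in (0 : ℝ)..T, w₁ s * Z₁ s ω) * ∫ t in (0 : ℝ)..T, w₂ t * Z₂ t ω) P ∧
    ∫ ω, (∫ s in (0 : ℝ)..T, w₁ s * Z₁ s ω) * (∫ t in (0 : ℝ)..T, w₂ t * Z₂ t ω) ∂P
      = ∫ t in (0 : ℝ)..T, ∫ s in (0 : ℝ)..T, w₁ s * w₂ t * ∫ ω, Z₁ s ω * Z₂ t ω ∂P := by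
  obtain ⟨C₁, hC₁⟩ := (isCompact_Icc (a := (0 : ℝ)) (b := T)).exists_bound_of_continuousOn
    hw₁.continuousOn
  obtain ⟨C₂, hC₂⟩ := (isCompact_Icc (a := (0 : ℝ)) (b := T)).exists_bound_of_continuousOn
    hw₂.continuousOn
  have hint := integrable_mul_timeIntegral (T := T) (K := K) (C := max C₁ C₂) hm₁ hm₂ hw₁ hw₂
    (fun s hs ↦ (hC₁ s (Set.Ioc_subset_Icc_self hs)).trans (le_max_left _ _))
    (fun s hs ↦ (hC₂ s (Set.Ioc_subset_Icc_self hs)).trans (le_max_right _ _)) hZ₁ hZ₂ hK₁ hK₂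
  simp only [intervalIntegral.integral_of_le hT]
  have hprod : ∀ ω, (∫ s in Set.Ioc 0 T, w₁ s * Z₁ s ω) * (∫ t in Set.Ioc 0 T, w₂ t * Z₂ t ω)
      = ∫ p, w₁ p.1 * Z₁ p.1 ω * (w₂ p.2 * Z₂ p.2 ω)
        ∂((volume.restrict (Set.Ioc 0 T)).prod (volume.restrict (Set.Ioc 0 T))) := fun ω ↦
    (integral_prod_mul (fun s ↦ w₁ s * Z₁ s ω) (fun t ↦ w₂ t * Z₂ t ω)).symm
  simp only [hprod]
  refine ⟨hint.integral_prod_right, ?_⟩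
  rw [← integral_integral_swap (f := fun (p : ℝ × ℝ) ω ↦
    w₁ p.1 * Z₁ p.1 ω * (w₂ p.2 * Z₂ p.2 ω)) hint, integral_prod_symm _ hint.integral_prod_left]
  congr 1; ext t; congr 1; ext s
  rw [← integral_const_mul]
  congr 1; ext ω
  ring

end TimeIntegral

/-! ### Second moments of the noise. -/

/-- The noise part `∫_0^T e^{-θ(T-s)} W_s ds` of the time integral of an OU process. -/
noncomputable def ouNoise {Ω : Type*} (θ T : ℝ) (W : ℝ≥0 → Ω → ℝ) (ω : Ω) : ℝ :=
  ∫ s in (0 : ℝ)..T, Real.exp (-(θ * (T - s))) * W s.toNNReal ω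

lemma covariance_congr_ae {Ω : Type*} [MeasurableSpace Ω] {P : Measure Ω} {X X' Y Y' : Ω → ℝ}
    (hX : X =ᵐ[P] X') (hY : Y =ᵐ[P] Y') : cov[X, Y; P] = cov[X', Y'; P] := by
  rw [covariance, covariance, integral_congr_ae hX, integral_congr_ae hY]
  refine integral_congr_ae ?_
  filter_upwards [hX, hY] with ω h1 h2
  rw [h1, h2]

lemma integral_sq_brownian {Ω : Type*} [MeasurableSpace Ω] {P : Measure Ω} {W : ℝ≥0 → Ω → ℝ}
    (hW : IsPreBrownianReal W P) (t : ℝ≥0) : ∫ ω, W t ω ^ 2 ∂P = t := by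
  have := hW.isGaussianProcess.isProbabilityMeasure
  have hL : MemLp (W t) 2 P := (hW.isGaussianProcess.hasGaussianLaw_eval t).memLp_two
  have h := hW.covariance_eval t t
  rw [covariance_eq_sub hL hL, hW.integral_eval] at h
  simpa [sq] using h

/-- The moments of the noise parts of two time integrals, driven by Brownian motions with
cross covariance `κ`. -/
lemma memLp_ouNoise_and_covariance {Ω : Type*} [MeasurableSpace Ω] {P : Measure Ω}
    {W₁ W₂ : ℝ≥0 → Ω → ℝ} (hW₁ : IsBrownianReal W₁ P) (hW₂ : IsBrownianReal W₂ P)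
    {κ : ℝ≥0 → ℝ≥0 → ℝ} (hκ : ∀ s t, cov[W₁ s, W₂ t; P] = κ s t) (θ₁ θ₂ : ℝ) {T : ℝ}
    (hT : 0 < T) :
    MemLp (ouNoise θ₁ T W₁) 2 P ∧ cov[ouNoise θ₁ T W₁, ouNoise θ₂ T W₂; P]
      = ∫ t in (0 : ℝ)..T, ∫ s in (0 : ℝ)..T, Real.exp (-(θ₁ * (T - s)))
          * Real.exp (-(θ₂ * (T - t))) * κ s.toNNReal t.toNNReal := by
  have := hW₁.isGaussianProcess.isProbabilityMeasure
  have key : ∀ (θ : ℝ) (W : ℝ≥0 → Ω → ℝ), IsBrownianReal W P → ∃ Z : ℝ → Ω → ℝ,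
      Measurable (Function.uncurry Z) ∧ (∀ s, Z s =ᵐ[P] W s.toNNReal) ∧ (∀ s, MemLp (Z s) 2 P) ∧
      -- The maximum with 1 lets the same bound cover the constant process 1, used below to compute
      -- the mean.
      (∀ s ∈ Set.Ioc 0 T, ∫ ω, Z s ω ^ 2 ∂P ≤ max T 1) ∧
      (ouNoise θ T W =ᵐ[P] fun ω ↦ ∫ s in (0 : ℝ)..T, Real.exp (-(θ * (T - s))) * Z s ω) ∧
      MemLp (fun ω ↦ ∫ s in (0 : ℝ)..T, Real.exp (-(θ * (T - s))) * Z s ω) 2 P ∧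
      ∫ ω, (∫ s in (0 : ℝ)..T, Real.exp (-(θ * (T - s))) * Z s ω) ∂P = 0 := by
    intro θ W hW
    obtain ⟨Z, hZm, -, hZW⟩ := exists_measurable_continuous_modification hW.aemeasurable hW.cont
    have hae : ∀ t, Z t =ᵐ[P] W t := fun t ↦ by filter_upwards [hZW] with ω h using h t
    have hm : Measurable (Function.uncurry fun s : ℝ ↦ Z s.toNNReal) :=
      hZm.comp (measurable_fst.real_toNNReal.prodMk measurable_snd)
    have hL : ∀ s : ℝ, MemLp (Z s.toNNReal) 2 P := fun s ↦
      (memLp_congr_ae (hae _)).2 (hW.isGaussianProcess.hasGaussianLaw_eval _).memLp_two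
    have hK : ∀ s ∈ Set.Ioc 0 T, ∫ ω, Z s.toNNReal ω ^ 2 ∂P ≤ max T 1 := fun s hs ↦ by
      have h : ∫ ω, Z s.toNNReal ω ^ 2 ∂P = ∫ ω, W s.toNNReal ω ^ 2 ∂P :=
        integral_congr_ae ((hae s.toNNReal).pow_const 2)
      rw [h, integral_sq_brownian hW.toIsPreBrownianReal, Real.coe_toNNReal _ hs.1.le]
      exact hs.2.trans (le_max_left _ _)
    have hw : Continuous fun s ↦ Real.exp (-(θ * (T - s))) := by fun_prop
    have hsm : AEStronglyMeasurable
        (fun ω ↦ ∫ s in (0 : ℝ)..T, Real.exp (-(θ * (T - s))) * Z s.toNNReal ω) P := by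
      simp only [intervalIntegral.integral_of_le hT.le]
      exact aestronglyMeasurable_timeIntegral hm hw T
    refine ⟨fun s ↦ Z s.toNNReal, hm, fun s ↦ hae _, hL, hK, ?_, ?_, ?_⟩
    · filter_upwards [hZW] with ω h
      simp only [ouNoise, h]
    · rw [memLp_two_iff_integrable_sq hsm]
      simpa only [sq] using (integral_mul_timeIntegral hT.le hm hm hw hw hL hL hK hK).1
    -- Pairing with the constant process 1 makes the product formula read `E[noise] · T = 0`.
    · have h := (integral_mul_timeIntegral (Z₂ := fun _ _ ↦ 1) (w₂ := fun _ ↦ 1) (P := P) hT.le hm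
        measurable_const hw continuous_const hL (fun _ ↦ memLp_const _) hK (by simp)).2
      have h0 : ∀ s : ℝ, ∫ ω, Z s.toNNReal ω ∂P = 0 := fun s ↦
        (integral_congr_ae (hae _)).trans (hW.integral_eval _)
      simp only [mul_one, h0, mul_zero, intervalIntegral.integral_const, smul_eq_mul, sub_zero] at h
      rw [integral_mul_const] at h
      exact (mul_eq_zero.1 h).resolve_right hT.ne'
  obtain ⟨Z₁, hm₁, hae₁, hL₁, hK₁, hY₁, hM₁, hE₁⟩ := key θ₁ W₁ hW₁
  obtain ⟨Z₂, hm₂, hae₂, hL₂, hK₂, hY₂, hM₂, hE₂⟩ := key θ₂ W₂ hW₂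
  refine ⟨(memLp_congr_ae hY₁).2 hM₁, ?_⟩
  have hprod : ∀ s t, ∫ ω, Z₁ s ω * Z₂ t ω ∂P = κ s.toNNReal t.toNNReal := fun s t ↦ by
    rw [← hκ, ← covariance_congr_ae (hae₁ s) (hae₂ t), covariance_eq_sub (hL₁ s) (hL₂ t),
      integral_congr_ae (hae₁ s), hW₁.integral_eval]
    simp
  rw [covariance_congr_ae hY₁ hY₂, covariance_eq_sub hM₁ hM₂, hE₁, zero_mul, sub_zero]
  simp only [Pi.mul_apply]
  rw [(integral_mul_timeIntegral hT.le hm₁ hm₂ (by fun_prop) (by fun_prop) hL₁ hL₂ hK₁ hK₂).2]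
  simp only [hprod]

lemma covariance_ouNoise_same {Ω : Type*} [MeasurableSpace Ω] {P : Measure Ω}
    {W : ℝ≥0 → Ω → ℝ} (hW : IsBrownianReal W P) (θ₁ θ₂ : ℝ) {T : ℝ} (hT : 0 < T) :
    cov[ouNoise θ₁ T W, ouNoise θ₂ T W; P] = expIntInner θ₁ θ₂ T := by
  rw [(memLp_ouNoise_and_covariance hW hW hW.covariance_eval θ₁ θ₂ hT).2,
    ← integral_integral_exp_mul_min θ₁ θ₂ hT.le]
  refine intervalIntegral.integral_congr fun t ht ↦ intervalIntegral.integral_congr fun s hs ↦ ?_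
  rw [Set.uIcc_of_le hT.le] at ht hs
  simp only [NNReal.coe_min, Real.coe_toNNReal _ ht.1, Real.coe_toNNReal _ hs.1]

lemma covariance_ouNoise_of_indepFun {Ω : Type*} [MeasurableSpace Ω] {P : Measure Ω}
    {W₁ W₂ : ℝ≥0 → Ω → ℝ} (hW₁ : IsBrownianReal W₁ P) (hW₂ : IsBrownianReal W₂ P)
    (h : IndepFun (fun ω t ↦ W₁ t ω) (fun ω t ↦ W₂ t ω) P) (θ₁ θ₂ : ℝ) {T : ℝ} (hT : 0 < T) :
    cov[ouNoise θ₁ T W₁, ouNoise θ₂ T W₂; P] = 0 := by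
  have hκ : ∀ s t, cov[W₁ s, W₂ t; P] = 0 := fun s t ↦
    (h.comp (measurable_pi_apply s) (measurable_pi_apply t)).covariance_eq_zero
      (hW₁.isGaussianProcess.hasGaussianLaw_eval s).memLp_two
      (hW₂.isGaussianProcess.hasGaussianLaw_eval t).memLp_two
  rw [(memLp_ouNoise_and_covariance hW₁ hW₂ hκ θ₁ θ₂ hT).2]
  simp

/-! ### Pathwise solution and exact variance formulas. -/

/-- Variation of constants for the time integral of a path of the OU equation. -/
lemma integral_of_path_eq {θ μ σ x₀ T : ℝ} {x w : ℝ≥0 → ℝ} (hx : Continuous x)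
    (hw : Continuous w) (hT : 0 ≤ T)
    (h : ∀ t : ℝ≥0, x t = x₀ + (∫ s in (0 : ℝ)..(t : ℝ), θ * (μ - x s.toNNReal)) + σ * w t) :
    ∫ s in (0 : ℝ)..T, x s.toNNReal
      = (∫ s in (0 : ℝ)..T, Real.exp (-(θ * (T - s))) * (x₀ + θ * μ * s))
        + σ * ∫ s in (0 : ℝ)..T, Real.exp (-(θ * (T - s))) * w s.toNNReal := by
  have hx' : Continuous fun s : ℝ ↦ x s.toNNReal := hx.comp continuous_real_toNNReal
  have hw' : Continuous fun s : ℝ ↦ w s.toNNReal := hw.comp continuous_real_toNNReal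
  have hI : ∀ t, HasDerivAt (fun t ↦ ∫ s in (0 : ℝ)..t, x s.toNNReal) (x t.toNNReal) t := fun t ↦
    intervalIntegral.integral_hasDerivAt_right (hx'.intervalIntegrable _ _)
      (hx'.stronglyMeasurableAtFilter _ _) hx'.continuousAt
  have hE : ∀ t, HasDerivAt (fun t ↦ Real.exp (-(θ * (T - t))))
      (Real.exp (-(θ * (T - t))) * θ) t := fun t ↦ by
    refine HasDerivAt.exp ?_
    convert! (((hasDerivAt_id t).const_sub T).const_mul θ).neg using 1
    simp
  have hxt : ∀ t : ℝ, 0 ≤ t → x t.toNNReal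
      = x₀ + θ * μ * t - θ * (∫ s in (0 : ℝ)..t, x s.toNNReal) + σ * w t.toNNReal := fun t ht ↦ by
    rw [h t.toNNReal, Real.coe_toNNReal _ ht, intervalIntegral.integral_const_mul,
      intervalIntegral.integral_sub (by simp) (hx'.intervalIntegrable _ _)]
    simp
    ring
  -- The integrating factor multiplies the time integral of `x`, which is differentiable, rather
  -- than `x` itself; continuity of `w` then suffices.
  have hderiv : ∀ t ∈ Set.uIcc 0 T,
      HasDerivAt (fun t ↦ Real.exp (-(θ * (T - t))) * ∫ s in (0 : ℝ)..t, x s.toNNReal)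
        (Real.exp (-(θ * (T - t))) * (x₀ + θ * μ * t)
          + σ * (Real.exp (-(θ * (T - t))) * w t.toNNReal)) t := fun t ht ↦ by
    rw [Set.uIcc_of_le hT] at ht
    refine ((hE t).mul (hI t)).congr_deriv ?_
    linear_combination (Real.exp (-(θ * (T - t)))) * hxt t ht.1
  have hfin := intervalIntegral.integral_eq_sub_of_hasDerivAt hderiv
    ((by fun_prop : Continuous _).intervalIntegrable _ _)
  rw [intervalIntegral.integral_add, intervalIntegral.integral_const_mul] at hfin
  · simpa using hfin.symm
  all_goals exact (by fun_prop : Continuous _).intervalIntegrable _ _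

lemma IsOUProcess.exists_timeAverage_ae_eq {Ω : Type u} [MeasurableSpace Ω] {P : Measure Ω}
    {θ μ σ x₀ T : ℝ} {W X : ℝ≥0 → Ω → ℝ} (hX : IsOUProcess θ μ σ x₀ W X P)
    (hW : IsBrownianReal W P) (hT : 0 < T) :
    ∃ c, timeAverage T X =ᵐ[P] fun ω ↦ c + σ * T⁻¹ * ouNoise θ T W ω := by
  refine ⟨T⁻¹ * ∫ s in (0 : ℝ)..T, Real.exp (-(θ * (T - s))) * (x₀ + θ * μ * s), ?_⟩
  filter_upwards [hX.continuous_paths, hX.integral_eq, hW.cont] with ω h1 h2 h3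
  rw [timeAverage, integral_of_path_eq h1 h3 hT.le h2, ouNoise]
  ring

lemma IsOUProcess.memLp_timeAverage {Ω : Type u} [MeasurableSpace Ω] {P : Measure Ω}
    {θ μ σ x₀ T : ℝ} {W X : ℝ≥0 → Ω → ℝ} (hX : IsOUProcess θ μ σ x₀ W X P)
    (hW : IsBrownianReal W P) (hT : 0 < T) : MemLp (timeAverage T X) 2 P := by
  have := hW.isGaussianProcess.isProbabilityMeasure
  obtain ⟨c, hc⟩ := hX.exists_timeAverage_ae_eq hW hT
  rw [memLp_congr_ae hc]
  exact (memLp_const c).add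
    ((memLp_ouNoise_and_covariance hW hW hW.covariance_eval θ θ hT).1.const_mul _)

lemma IsOUProcess.covariance_timeAverage {Ω : Type u} [MeasurableSpace Ω] {P : Measure Ω}
    {θ₁ θ₂ μ₁ μ₂ σ₁ σ₂ x₁ x₂ T : ℝ} {W₁ W₂ X₁ X₂ : ℝ≥0 → Ω → ℝ}
    (hX₁ : IsOUProcess θ₁ μ₁ σ₁ x₁ W₁ X₁ P) (hX₂ : IsOUProcess θ₂ μ₂ σ₂ x₂ W₂ X₂ P)
    (hW₁ : IsBrownianReal W₁ P) (hW₂ : IsBrownianReal W₂ P) (hT : 0 < T) :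
    cov[timeAverage T X₁, timeAverage T X₂; P]
      = σ₁ * σ₂ * (T ^ 2)⁻¹ * cov[ouNoise θ₁ T W₁, ouNoise θ₂ T W₂; P] := by
  have := hW₁.isGaussianProcess.isProbabilityMeasure
  obtain ⟨c₁, hc₁⟩ := hX₁.exists_timeAverage_ae_eq hW₁ hT
  obtain ⟨c₂, hc₂⟩ := hX₂.exists_timeAverage_ae_eq hW₂ hT
  have hM : ∀ (θ a : ℝ) (W : ℝ≥0 → Ω → ℝ), IsBrownianReal W P →
      Integrable (fun ω ↦ a * ouNoise θ T W ω) P := fun θ a W hW ↦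
    ((memLp_ouNoise_and_covariance hW hW hW.covariance_eval θ θ hT).1.integrable
      one_le_two).const_mul a
  rw [covariance_congr_ae hc₁ hc₂, covariance_const_add_left (hM _ _ _ hW₁),
    covariance_const_add_right (hM _ _ _ hW₂), covariance_const_mul_left,
    covariance_const_mul_right]
  ring

lemma IsOUProcess.variance_timeAverage {Ω : Type u} [MeasurableSpace Ω] {P : Measure Ω}
    {θ μ σ x₀ T : ℝ} {W X : ℝ≥0 → Ω → ℝ} (hX : IsOUProcess θ μ σ x₀ W X P)
    (hW : IsBrownianReal W P) (hT : 0 < T) :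
    Var[timeAverage T X; P] = σ ^ 2 * (T ^ 2)⁻¹ * expIntInner θ θ T := by
  rw [← covariance_self (hX.memLp_timeAverage hW hT).aemeasurable,
    hX.covariance_timeAverage hX hW hW hT, covariance_ouNoise_same hW θ θ hT]
  ring

lemma IsCommonPathOU.covariance_eq {Ω : Type u} [MeasurableSpace Ω] {P : Measure Ω}
    {θ₁ θ₂ σ₁ σ₂ μ x₀ T : ℝ} {X₁ X₂ : ℝ≥0 → Ω → ℝ}
    (h : IsCommonPathOU θ₁ θ₂ σ₁ σ₂ μ x₀ X₁ X₂ P) (hT : 0 < T) :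
    cov[timeAverage T X₁, timeAverage T X₂; P]
      = σ₁ * σ₂ * (T ^ 2)⁻¹ * expIntInner θ₁ θ₂ T := by
  obtain ⟨W, hW, h₁, h₂⟩ := h
  rw [h₁.covariance_timeAverage h₂ hW hW hT, covariance_ouNoise_same hW θ₁ θ₂ hT]

lemma IsCommonPathOU.varDiff_eq {Ω : Type u} [MeasurableSpace Ω] {P : Measure Ω}
    {θ₁ θ₂ σ₁ σ₂ μ x₀ T : ℝ} {X₁ X₂ : ℝ≥0 → Ω → ℝ}
    (h : IsCommonPathOU θ₁ θ₂ σ₁ σ₂ μ x₀ X₁ X₂ P) (hT : 0 < T) :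
    varDiff T X₁ X₂ P = (T ^ 2)⁻¹ * (σ₁ ^ 2 * expIntInner θ₁ θ₁ T
      - 2 * (σ₁ * σ₂ * expIntInner θ₁ θ₂ T) + σ₂ ^ 2 * expIntInner θ₂ θ₂ T) := by
  have hcov := h.covariance_eq hT
  obtain ⟨W, hW, h₁, h₂⟩ := h
  have := hW.isGaussianProcess.isProbabilityMeasure
  rw [varDiff, variance_fun_sub (h₁.memLp_timeAverage hW hT) (h₂.memLp_timeAverage hW hT), hcov,
    h₁.variance_timeAverage hW hT, h₂.variance_timeAverage hW hT]
  ring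

lemma IsIndependentOU.varDiff_eq {Ω : Type u} [MeasurableSpace Ω] {P : Measure Ω}
    {θ₁ θ₂ σ₁ σ₂ μ x₀ T : ℝ} {X₁ X₂ : ℝ≥0 → Ω → ℝ}
    (h : IsIndependentOU θ₁ θ₂ σ₁ σ₂ μ x₀ X₁ X₂ P) (hT : 0 < T) :
    varDiff T X₁ X₂ P
      = (T ^ 2)⁻¹ * (σ₁ ^ 2 * expIntInner θ₁ θ₁ T + σ₂ ^ 2 * expIntInner θ₂ θ₂ T) := by
  obtain ⟨W₁, W₂, hW₁, hW₂, hind, h₁, h₂⟩ := h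
  have := hW₁.isGaussianProcess.isProbabilityMeasure
  rw [varDiff, variance_fun_sub (h₁.memLp_timeAverage hW₁ hT) (h₂.memLp_timeAverage hW₂ hT),
    h₁.covariance_timeAverage h₂ hW₁ hW₂ hT, covariance_ouNoise_of_indepFun hW₁ hW₂ hind _ _ hT,
    h₁.variance_timeAverage hW₁ hT, h₂.variance_timeAverage hW₂ hT]
  ring

/-! ### Difference schemes and assembly of the theorem. -/

lemma DiffScheme.abs_upper_sub_le (d : DiffScheme) (p ε : ℝ) : |d.upper p ε - p| ≤ |ε| := by
  cases d <;> simp [DiffScheme.upper]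

lemma DiffScheme.abs_lower_sub_le (d : DiffScheme) (p ε : ℝ) : |d.lower p ε - p| ≤ |ε| := by
  cases d <;> simp [DiffScheme.lower]

/-- The factor is 2 for the central scheme and 1 for the others; its square is the constant 4 or 1
in the `σ` perturbation. -/
lemma DiffScheme.upper_sub_lower (d : DiffScheme) (p ε : ℝ) :
    d.upper p ε - d.lower p ε = ε * (d.upper 0 1 - d.lower 0 1) := by
  cases d <;> simp [DiffScheme.upper, DiffScheme.lower]
  ring

lemma abs_sq_sub_sq_le {p q ε : ℝ} (hq : |q - p| ≤ |ε|) (hε : |ε| < p) :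
    |q ^ 2 - p ^ 2| ≤ 3 * p * |ε| := by
  have hp : 0 < p := (abs_nonneg ε).trans_lt hε
  have h1 := abs_le.1 hq
  have h2 : |q + p| ≤ 3 * p := abs_le.2 ⟨by linarith, by linarith⟩
  calc |q ^ 2 - p ^ 2| = |q + p| * |q - p| := by rw [← abs_mul]; ring_nf
    _ ≤ 3 * p * |ε| := mul_le_mul h2 hq (abs_nonneg _) (by linarith)

lemma half_le_of_abs_sub_le {p q ε : ℝ} (hq : |q - p| ≤ |ε|) (hε : |ε| ≤ p / 2) : p / 2 ≤ q := by
  linarith [(abs_le.1 hq).1]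

theorem mainTheorem3 :
    -- the time averages are square integrable, so that (co)variances are genuine
    (∀ θ σ μ x₀ T : ℝ, 0 < θ → 0 < σ → 0 < T →
      ∀ (Ω : Type u) [MeasurableSpace Ω] (P : Measure Ω) (W X : ℝ≥0 → Ω → ℝ),
        IsBrownianReal W P → IsOUProcess θ μ σ x₀ W X P →
          MemLp (timeAverage T X) 2 P) ∧
    -- covariance under common random paths
    (∀ θ₁ θ₂ σ₁ σ₂ : ℝ, 0 < θ₁ → 0 < θ₂ → 0 < σ₁ → 0 < σ₂ →
      ∃ C : ℝ, ∀ μ x₀ T : ℝ, 0 < T →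
        ∀ (Ω : Type u) [MeasurableSpace Ω] (P : Measure Ω) (X₁ X₂ : ℝ≥0 → Ω → ℝ),
          IsCommonPathOU θ₁ θ₂ σ₁ σ₂ μ x₀ X₁ X₂ P →
            cov[timeAverage T X₁, timeAverage T X₂; P]
              = σ₁ * σ₂ * (T ^ 2)⁻¹ * ∫ t in (0 : ℝ)..T, ∫ s in (0 : ℝ)..T,
                  Real.exp (-θ₁ * s - θ₂ * t)
                    * ∫ r in (0 : ℝ)..(min s t), Real.exp ((θ₁ + θ₂) * r) ∧
            |cov[timeAverage T X₁, timeAverage T X₂; P]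
              - σ₁ * σ₂ * T⁻¹ * ((θ₁ * θ₂ + θ₂ ^ 2)⁻¹ + (θ₁ ^ 2 + θ₁ * θ₂)⁻¹)| ≤ C / T ^ 2) ∧
    -- perturbation of `θ`, common random paths, central difference
    (∀ θ σ : ℝ, 0 < θ → 0 < σ →
      ∃ (r : ℝ → ℝ) (C : ℝ), (∀ T : ℝ, 0 < T → |r T| ≤ C / T ^ 2) ∧
        ∀ μ x₀ T ε : ℝ, 0 < T → |ε| ≤ θ / 2 →
          ∀ (Ω : Type u) [MeasurableSpace Ω] (P : Measure Ω) (X₁ X₂ : ℝ≥0 → Ω → ℝ),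
            IsCommonPathOU (θ + ε) (θ - ε) σ σ μ x₀ X₁ X₂ P →
              |varDiff T X₁ X₂ P - ε ^ 2 * (4 * σ ^ 2 / (T * θ ^ 4) + r T)| ≤ C * ε ^ 4) ∧
    -- perturbation of `θ`, common random paths, every first order difference
    (∀ (d : DiffScheme) (θ σ : ℝ), 0 < θ → 0 < σ →
      ∃ C : ℝ, ∀ μ x₀ T ε : ℝ, 0 < T → |ε| ≤ θ / 2 →
        ∀ (Ω : Type u) [MeasurableSpace Ω] (P : Measure Ω) (X₁ X₂ : ℝ≥0 → Ω → ℝ),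
          IsCommonPathOU (d.upper θ ε) (d.lower θ ε) σ σ μ x₀ X₁ X₂ P →
            varDiff T X₁ X₂ P ≤ C * ε ^ 2) ∧
    -- perturbation of `θ`, independent sampling
    (∀ (d : DiffScheme) (θ σ : ℝ), 0 < θ → 0 < σ →
      ∃ C : ℝ, ∀ μ x₀ T ε : ℝ, 0 < T → |ε| ≤ θ / 2 →
        ∀ (Ω : Type u) [MeasurableSpace Ω] (P : Measure Ω) (X₁ X₂ : ℝ≥0 → Ω → ℝ),
          IsIndependentOU (d.upper θ ε) (d.lower θ ε) σ σ μ x₀ X₁ X₂ P →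
            |varDiff T X₁ X₂ P - indepLeading θ σ T| ≤ C * |ε| ∧
            varDiff T X₁ X₂ P ≤ C) ∧
    -- perturbation of `σ`, common random paths: the constant is `4` for the central difference
    -- and `1` for the one-sided ones
    (∀ (d : DiffScheme) (θ : ℝ), 0 < θ →
      ∃ (r : ℝ → ℝ) (C : ℝ), (∀ T : ℝ, 0 < T → |r T| ≤ C / T ^ 2) ∧
        ∀ σ μ x₀ T ε : ℝ, 0 < T → |ε| < σ →
          ∀ (Ω : Type u) [MeasurableSpace Ω] (P : Measure Ω) (X₁ X₂ : ℝ≥0 → Ω → ℝ),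
            IsCommonPathOU θ θ (d.upper σ ε) (d.lower σ ε) μ x₀ X₁ X₂ P →
              varDiff T X₁ X₂ P
                = ε ^ 2 * ((d.upper 0 1 - d.lower 0 1) ^ 2 / (T * θ ^ 2) + r T)) ∧
    -- perturbation of `σ`, independent sampling, central difference
    (∀ θ σ : ℝ, 0 < θ → 0 < σ →
      ∃ C : ℝ, ∀ μ x₀ T ε : ℝ, 0 < T → |ε| < σ →
        ∀ (Ω : Type u) [MeasurableSpace Ω] (P : Measure Ω) (X₁ X₂ : ℝ≥0 → Ω → ℝ),
          IsIndependentOU θ θ (σ + ε) (σ - ε) μ x₀ X₁ X₂ P →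
            |varDiff T X₁ X₂ P - (2 * σ ^ 2 / (T * θ ^ 2) + ε ^ 2 * (2 / (T * θ ^ 2)))|
              ≤ C / T ^ 2 * (1 + ε ^ 2)) ∧
    -- perturbation of `σ`, independent sampling, every first order difference
    (∀ (d : DiffScheme) (θ σ : ℝ), 0 < θ → 0 < σ →
      ∃ C : ℝ, ∀ μ x₀ T ε : ℝ, 0 < T → |ε| < σ →
        ∀ (Ω : Type u) [MeasurableSpace Ω] (P : Measure Ω) (X₁ X₂ : ℝ≥0 → Ω → ℝ),
          IsIndependentOU θ θ (d.upper σ ε) (d.lower σ ε) μ x₀ X₁ X₂ P →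
            |varDiff T X₁ X₂ P - indepLeading θ σ T| ≤ C * |ε| ∧
            varDiff T X₁ X₂ P ≤ C) := by
  refine ⟨?_, ?_, ?_, ?_, ?_, ?_, ?_, ?_⟩
  · intro θ σ μ x₀ T _ _ hT Ω _ P W X hW hX
    exact hX.memLp_timeAverage hW hT
  · intro θ₁ θ₂ σ₁ σ₂ h₁ h₂ hσ₁ hσ₂
    refine ⟨σ₁ * σ₂ * ((1 / θ₁ + 1 / θ₂ + 1 / (θ₁ + θ₂)) / (θ₁ * θ₂)),
      fun μ x₀ T hT Ω _ P X₁ X₂ h ↦ ?_⟩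
    rw [h.covariance_eq hT, integral_integral_exp_mul_integral_exp θ₁ θ₂ hT.le]
    refine ⟨rfl, ?_⟩
    have e : σ₁ * σ₂ * (T ^ 2)⁻¹ * expIntInner θ₁ θ₂ T
        - σ₁ * σ₂ * T⁻¹ * ((θ₁ * θ₂ + θ₂ ^ 2)⁻¹ + (θ₁ ^ 2 + θ₁ * θ₂)⁻¹)
        = σ₁ * σ₂ * (expIntInner θ₁ θ₂ T - T / (θ₁ * θ₂)) / T ^ 2 := by
      have : (θ₁ * θ₂ + θ₂ ^ 2)⁻¹ + (θ₁ ^ 2 + θ₁ * θ₂)⁻¹ = 1 / (θ₁ * θ₂) := by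
        field_simp
      rw [this]
      field_simp
    rw [e, abs_div, abs_of_pos (by positivity : 0 < T ^ 2), abs_mul,
      abs_of_pos (mul_pos hσ₁ hσ₂)]
    gcongr
    exact abs_expIntInner_sub_le h₁ h₂ hT.le
  · intro θ σ hθ hσ
    obtain ⟨C₁, hC₁⟩ := exists_abs_integral_sq_expIntDeriv_sub_le hθ
    obtain ⟨C₂, hC₂, hC₂'⟩ := exists_abs_integral_sq_central_sub_le hθ
    -- The remainder is the error in `‖h‖² ≈ T/θ⁴`, free of `ε`; the maximum supplies one constant
    -- for both bounds.
    refine ⟨fun T ↦ 4 * σ ^ 2 * ((∫ u in (0 : ℝ)..T, expIntDeriv θ u ^ 2) - T / θ ^ 4) / T ^ 2,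
      max (4 * σ ^ 2 * C₁) (σ ^ 2 * C₂), fun T hT ↦ ?_, fun μ x₀ T ε hT hε Ω _ P X₁ X₂ h ↦ ?_⟩
    · rw [abs_div, abs_of_pos (by positivity : 0 < T ^ 2), abs_mul,
        abs_of_nonneg (by positivity : 0 ≤ 4 * σ ^ 2)]
      gcongr
      exact (mul_le_mul_of_nonneg_left (hC₁ T hT.le) (by positivity)).trans (le_max_left _ _)
    · have e : varDiff T X₁ X₂ P - ε ^ 2 * (4 * σ ^ 2 / (T * θ ^ 4)
          + 4 * σ ^ 2 * ((∫ u in (0 : ℝ)..T, expIntDeriv θ u ^ 2) - T / θ ^ 4) / T ^ 2)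
          = σ ^ 2 / T ^ 2 * ((∫ u in (0 : ℝ)..T, (expInt (θ + ε) u - expInt (θ - ε) u) ^ 2)
            - 4 * ε ^ 2 * ∫ u in (0 : ℝ)..T, expIntDeriv θ u ^ 2) := by
        rw [h.varDiff_eq hT, ← expIntInner_self_sub_add]
        field_simp
        ring
      rw [e, abs_mul, abs_of_nonneg (by positivity)]
      calc σ ^ 2 / T ^ 2 * |_| ≤ σ ^ 2 / T ^ 2 * (C₂ * ε ^ 4 * T ^ 2) := by
            gcongr
            exact hC₂' T ε hT.le hε
        _ = σ ^ 2 * C₂ * ε ^ 4 := by field_simp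
        _ ≤ _ := by gcongr; exact le_max_right _ _
  · intro d θ σ hθ hσ
    -- Both rates are at least `c = θ/2`, because `|ε| ≤ θ/2`.
    refine ⟨σ ^ 2 * (8 / (θ / 2) ^ 3 * (d.upper 0 1 - d.lower 0 1) ^ 2),
      fun μ x₀ T ε hT hε Ω _ P X₁ X₂ h ↦ ?_⟩
    have e : varDiff T X₁ X₂ P = σ ^ 2 / T ^ 2
        * ∫ u in (0 : ℝ)..T, (expInt (d.upper θ ε) u - expInt (d.lower θ ε) u) ^ 2 := by
      rw [h.varDiff_eq hT, ← expIntInner_self_sub_add]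
      field_simp
    have hle := integral_sq_expInt_sub_le (half_pos hθ)
      (half_le_of_abs_sub_le (d.abs_upper_sub_le θ ε) hε)
      (half_le_of_abs_sub_le (d.abs_lower_sub_le θ ε) hε) hT.le
    rw [sq_abs, d.upper_sub_lower] at hle
    rw [e]
    refine (mul_le_mul_of_nonneg_left hle (by positivity)).trans_eq ?_
    field_simp
  · intro d θ σ hθ hσ
    -- The first summand serves the `O(ε)` bound, the second the `O(1)` bound.
    refine ⟨σ ^ 2 * (8 / (θ / 2) ^ 2) + σ ^ 2 * (4 / θ),
      fun μ x₀ T ε hT hε Ω _ P X₁ X₂ h ↦ ?_⟩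
    have hu := half_le_of_abs_sub_le (d.abs_upper_sub_le θ ε) hε
    have hl := half_le_of_abs_sub_le (d.abs_lower_sub_le θ ε) hε
    have hθ2 := half_pos hθ
    rw [h.varDiff_eq hT, indepLeading_eq hθ hT]
    constructor
    · have key : ∀ a, |a - θ| ≤ |ε| → θ / 2 ≤ a →
          |expIntInner a a T - expIntInner θ θ T| ≤ 4 / (θ / 2) ^ 2 * |ε| * T ^ 2 :=
        fun a ha ha' ↦ (abs_expIntInner_self_sub_le hθ2 ha' (by linarith) hT.le).trans (by gcongr)
      have e : (T ^ 2)⁻¹ * (σ ^ 2 * expIntInner (d.upper θ ε) (d.upper θ ε) T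
          + σ ^ 2 * expIntInner (d.lower θ ε) (d.lower θ ε) T)
          - 2 * σ ^ 2 * (T ^ 2)⁻¹ * expIntInner θ θ T
          = σ ^ 2 / T ^ 2 * ((expIntInner (d.upper θ ε) (d.upper θ ε) T - expIntInner θ θ T)
            + (expIntInner (d.lower θ ε) (d.lower θ ε) T - expIntInner θ θ T)) := by
        ring
      rw [e, abs_mul, abs_of_nonneg (by positivity)]
      have hsum := (abs_add_le _ _).trans (add_le_add (key _ (d.abs_upper_sub_le θ ε) hu)
        (key _ (d.abs_lower_sub_le θ ε) hl))
      calc σ ^ 2 / T ^ 2 * |_| ≤ _ := mul_le_mul_of_nonneg_left hsum (by positivity)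
        _ = σ ^ 2 * (8 / (θ / 2) ^ 2) * |ε| := by
            field_simp
            ring
        _ ≤ _ := by
            gcongr
            exact le_add_of_nonneg_right (by positivity)
    · have key : ∀ a, θ / 2 ≤ a → expIntInner a a T ≤ 2 / θ * T ^ 2 := fun a ha ↦ by
        refine (expIntInner_self_le (hθ2.trans_le ha) hT.le).trans ?_
        refine mul_le_mul_of_nonneg_right ?_ (sq_nonneg T)
        refine (one_div_le_one_div_of_le hθ2 ha).trans_eq ?_
        field_simp
      calc (T ^ 2)⁻¹ * (σ ^ 2 * expIntInner (d.upper θ ε) (d.upper θ ε) T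
            + σ ^ 2 * expIntInner (d.lower θ ε) (d.lower θ ε) T)
          ≤ (T ^ 2)⁻¹ * (σ ^ 2 * (2 / θ * T ^ 2) + σ ^ 2 * (2 / θ * T ^ 2)) := by
            gcongr
            exacts [key _ hu, key _ hl]
        _ = σ ^ 2 * (4 / θ) := by
            field_simp
            ring
        _ ≤ _ := le_add_of_nonneg_left (by positivity)
  · intro d θ hθ
    refine ⟨fun T ↦ (d.upper 0 1 - d.lower 0 1) ^ 2 * (expIntInner θ θ T - T / (θ * θ)) / T ^ 2,
      (d.upper 0 1 - d.lower 0 1) ^ 2 * ((1 / θ + 1 / θ + 1 / (θ + θ)) / (θ * θ)),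
      fun T hT ↦ ?_, fun σ μ x₀ T ε hT hε Ω _ P X₁ X₂ h ↦ ?_⟩
    · rw [abs_div, abs_of_pos (by positivity : 0 < T ^ 2), abs_mul, abs_of_nonneg (sq_nonneg _)]
      gcongr
      exact abs_expIntInner_sub_le hθ hθ hT.le
    · have e : varDiff T X₁ X₂ P
          = (d.upper σ ε - d.lower σ ε) ^ 2 * expIntInner θ θ T / T ^ 2 := by
        rw [h.varDiff_eq hT]
        ring
      rw [e, d.upper_sub_lower]
      field_simp
      ring
  · intro θ σ hθ hσ
    have hK := fun T (hT : 0 < T) ↦ abs_expIntInner_sub_le hθ hθ (T := T) hT.le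
    have hK0 : 0 ≤ (1 / θ + 1 / θ + 1 / (θ + θ)) / (θ * θ) := by positivity
    generalize (1 / θ + 1 / θ + 1 / (θ + θ)) / (θ * θ) = K at hK hK0
    -- Chosen through `σ² + ε² ≤ (σ² + 1)(1 + ε²)`.
    refine ⟨2 * (σ ^ 2 + 1) * K, fun μ x₀ T ε hT hε Ω _ P X₁ X₂ h ↦ ?_⟩
    have e : varDiff T X₁ X₂ P - (2 * σ ^ 2 / (T * θ ^ 2) + ε ^ 2 * (2 / (T * θ ^ 2)))
        = 2 * (σ ^ 2 + ε ^ 2) * (expIntInner θ θ T - T / (θ * θ)) / T ^ 2 := by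
      rw [h.varDiff_eq hT]
      field_simp
      ring
    rw [e, abs_div, abs_of_pos (by positivity : 0 < T ^ 2), abs_mul,
      abs_of_nonneg (by positivity : 0 ≤ 2 * (σ ^ 2 + ε ^ 2)), div_mul_eq_mul_div]
    refine div_le_div_of_nonneg_right ?_ (sq_nonneg T)
    calc 2 * (σ ^ 2 + ε ^ 2) * |expIntInner θ θ T - T / (θ * θ)|
        ≤ 2 * ((σ ^ 2 + 1) * (1 + ε ^ 2)) * K := by
          gcongr
          · nlinarith [mul_nonneg (sq_nonneg σ) (sq_nonneg ε)]
          · exact hK T hT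
      _ = _ := by ring
  · intro d θ σ hθ hσ
    -- Each squared parameter differs from `σ²` by at most `3σ|ε|` and is at most `4σ²`; the common
    -- factor `T⁻² ‖g_θ‖²` is at most `1/θ`.
    refine ⟨6 * σ / θ + 8 * σ ^ 2 / θ, fun μ x₀ T ε hT hε Ω _ P X₁ X₂ h ↦ ?_⟩
    have hu := abs_sq_sub_sq_le (d.abs_upper_sub_le σ ε) hε
    have hl := abs_sq_sub_sq_le (d.abs_lower_sub_le σ ε) hε
    have hJ0 : 0 ≤ (T ^ 2)⁻¹ * expIntInner θ θ T :=
      mul_nonneg (by positivity) (expIntInner_self_nonneg θ hT.le)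
    have hJ : (T ^ 2)⁻¹ * expIntInner θ θ T ≤ 1 / θ := by
      refine (mul_le_mul_of_nonneg_left (expIntInner_self_le hθ hT.le) (by positivity)).trans_eq ?_
      field_simp
    have e : varDiff T X₁ X₂ P
        = (d.upper σ ε ^ 2 + d.lower σ ε ^ 2) * ((T ^ 2)⁻¹ * expIntInner θ θ T) := by
      rw [h.varDiff_eq hT]
      ring
    rw [indepLeading_eq hθ hT, e, mul_assoc (2 * σ ^ 2)]
    generalize (T ^ 2)⁻¹ * expIntInner θ θ T = J at hJ0 hJ
    constructor
    · have hsum : |d.upper σ ε ^ 2 + d.lower σ ε ^ 2 - 2 * σ ^ 2| ≤ 6 * σ * |ε| := by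
        rw [show d.upper σ ε ^ 2 + d.lower σ ε ^ 2 - 2 * σ ^ 2
          = (d.upper σ ε ^ 2 - σ ^ 2) + (d.lower σ ε ^ 2 - σ ^ 2) by ring]
        linarith [abs_add_le (d.upper σ ε ^ 2 - σ ^ 2) (d.lower σ ε ^ 2 - σ ^ 2)]
      rw [← sub_mul, abs_mul, abs_of_nonneg hJ0]
      calc _ ≤ 6 * σ * |ε| * (1 / θ) := mul_le_mul hsum hJ hJ0 (by positivity)
        _ = 6 * σ / θ * |ε| := by ring
        _ ≤ _ := by
            gcongr
            exact le_add_of_nonneg_right (by positivity)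
    · have hsum : d.upper σ ε ^ 2 + d.lower σ ε ^ 2 ≤ 8 * σ ^ 2 := by
        nlinarith [(abs_le.1 hu).2, (abs_le.1 hl).2]
      calc _ ≤ 8 * σ ^ 2 * (1 / θ) := mul_le_mul hsum hJ hJ0 (by positivity)
        _ = 8 * σ ^ 2 / θ := by ring
        _ ≤ _ := le_add_of_nonneg_left (by positivity)
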